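/- Notation. Let $I=[-1,1]$, $\alpha\ge -\tfrac12$, $\omega(x)=(1-x^2)^{\alpha}$, $\|g\|_\omega=\big(\int_{-1}^1|g(x)|^2\omega(x)\,dx\big)^{1/2}$, let $\|g\|_\infty$ be the (essential) supremum of $|g|$ over $I$, and let $\gamma_{\alpha,\alpha}=\int_{-1}^1\omega(x)\,dx=2^{2\alpha+1}B(\alpha+1,\alpha+1)$. Let $\widetilde P_k$ $(k\ge 0)$ be the Jacobi polynomials with both parameters equal to $\alpha$, normalized by $\|\widetilde P_k\|_\omega=1$. Let $X_1,\dots,X_n$ be i.i.d. random variables with density $\omega/\gamma_{\alpha,\alpha}$ on $I$ (the beta distribution $B(\alpha+1,\alpha+1)$ over $I$), and let $Y_i=f(X_i)+\varepsilon_i$, $1\le i\le n$, where $\varepsilon_1,\dots,\varepsilon_n$ are real random variables; put $\pmb\eta_n=\max_{1\le i\le n}|\varepsilon_i|$. For $N+1\le n$ let $B_N=\big[n^{-1/2}\,\widetilde P_{k-1}(X_j)\big]_{1\le j\le n,\,1\le k\le N+1}$ and $A_N=B_N'B_N$, let $\kappa_2(A_N)$ be the $2$-norm condition number of $A_N$,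 and, when $A_N$ is invertible, let $$\widehat f_{n,N}=\sum_{k=1}^{N+1}\widehat c_k\,\widetilde P_{k-1},\qquad (\widehat c_1,\dots,\widehat c_{N+1})'=A_N^{-1}B_N'\,\tfrac1{\sqrt n}(Y_1,\dots,Y_n)'.$$ A function $\overline f$ on $\mathbb R$ is $c$-bandlimited if $\overline f\in L^2(\mathbb R)$ and its Fourier transform $\int \overline f(x)e^{-ix\xi}\,dx$ (in the $L^2$ sense) is supported in $[-c,c]$. Corollary 2 (bandlimited regression function). For every $\alpha\ge-\tfrac12$ there is a constant $C_\alpha>0$, depending only on $\alpha$, such that the following holds. Let $c>0$, let $f:I\to\mathbb R$ be the restriction to $I$ of a $c$-bandlimited function $\overline f$, with $\|f\|_\omega\neq 0$, and let $0<\delta<1$. Then there are $n_0,N_0$ such that for all $n\ge n_0$ and $N\ge N_0$ with $N+1\le n$, the denominator below is positive and, with probability at least $(1-\delta)^2$, the matrix $A_N$ is invertible and $$\|f-\widehat f_{n,N}\|_\omega\le \eta_N^{(\alpha)}\|\overline f\|_{L^2(\mathbb R)}+\sqrt{2\kappa_2(A_N)}\;\frac{\big(\frac1n\log\frac2\delta\big)^{1/4}+\dfrac{\eta_N^{(\alpha)}\|\overline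 f\|_{L^2(\mathbb R)}}{\sqrt{\gamma_{\alpha,\alpha}}}+\pmb\eta_n}{\dfrac1{\sqrt{\gamma_{\alpha,\alpha}}}-2\big(\frac1n\log\frac2\delta\big)^{1/4}\dfrac{\|f\|_\infty}{\|f\|_\omega}},$$ where $$\eta_N^{(\alpha)}=c^{-1/2}\,C_\alpha\Big(\frac{ec}{2N+2}\Big)^{N+2}.$$ -/

import Mathlib

open MeasureTheory ProbabilityTheory Set
open scoped FourierTransform ENNReal

noncomputable section

namespace JacobiRegression

/-- The Jacobi weight `ω_{α,β}(x) = (1 - x)^α (1 + x)^β`, used on `I = [-1, 1]`. -/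
def weight (α β x : ℝ) : ℝ := (1 - x) ^ α * (1 + x) ^ β

/-- The measure `ω_{α,β}(x) dx` on `I = [-1, 1]`. -/
def weightMeasure (α β : ℝ) : Measure ℝ :=
  (volume.restrict (Icc (-1 : ℝ) 1)).withDensity fun x => ENNReal.ofReal (weight α β x)

/-- The norm `‖g‖_ω = (∫_{-1}^1 |g(x)|² ω_{α,β}(x) dx)^{1/2}`. -/
def weightedNorm (α β : ℝ) (g : ℝ → ℝ) : ℝ := (eLpNorm g 2 (weightMeasure α β)).toReal

/-- The (essential) supremum norm on `I = [-1, 1]`. -/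
def supNorm (g : ℝ → ℝ) : ℝ := (eLpNorm g ∞ (volume.restrict (Icc (-1 : ℝ) 1))).toReal

/-- The norm of `L²(ℝ)`. -/
def l2Norm (g : ℝ → ℂ) : ℝ := (eLpNorm g 2 (volume : Measure ℝ)).toReal

/-- `γ_{α,β} = B(α + 1, β + 1) 2^{α + β + 1}`, the total mass of the weight. -/
def gammaConst (α β : ℝ) : ℝ := ProbabilityTheory.beta (α + 1) (β + 1) * 2 ^ (α + β + 1)

/-- The beta distribution over `I = [-1, 1]`, of density `ω_{α,β} / γ_{α,β}`. -/
def betaLaw (α β : ℝ) : Measure ℝ :=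
  (volume.restrict (Icc (-1 : ℝ) 1)).withDensity fun x =>
    ENNReal.ofReal (weight α β x / gammaConst α β)

/-- The classical Jacobi polynomial
`P_k^{(α,β)}(x) = ∑ₛ C(k + α, k - s) C(k + β, s) ((x - 1) / 2)^s ((x + 1) / 2)^{k - s}`. -/
def jacobi (α β : ℝ) (k : ℕ) : Polynomial ℝ :=
  ∑ s ∈ Finset.range (k + 1),
    Polynomial.C (Ring.choose ((k : ℝ) + α) (k - s) * Ring.choose ((k : ℝ) + β) s) *
      (Polynomial.C (1 / 2) * (Polynomial.X - 1)) ^ s *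
      (Polynomial.C (1 / 2) * (Polynomial.X + 1)) ^ (k - s)

theorem choose_eq (a : ℝ) (j : ℕ) :
    Ring.choose a j = (descPochhammer ℝ j).eval a / j.factorial := by
  have h := Ring.descPochhammer_eq_factorial_smul_choose a j
  have h2 : (descPochhammer ℤ j).smeval a = (descPochhammer ℝ j).eval a := by
    rw [← descPochhammer_map (Int.castRingHom ℝ), Polynomial.eval_map, Polynomial.eval₂_eq_sum, Polynomial.smeval_eq_sum]
    simp [Polynomial.smul_pow, Polynomial.sum_def]
  rw [h2] at h
  rw [h, nsmul_eq_mul]; field_simp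

/-- The Rodrigues formula, which characterizes `jacobi α β k`. -/
theorem weight_mul_jacobi (α β : ℝ) (k : ℕ) {x : ℝ} (hx : x ∈ Ioo (-1 : ℝ) 1) :
    weight α β x * (jacobi α β k).eval x =
      (-1) ^ k / (2 ^ k * k.factorial) *
        iteratedDeriv k (fun y => weight α β y * (1 - y ^ 2) ^ k) x := by
  obtain ⟨h1, h2⟩ := hx
  have p1 : 0 < 1 - x := by linarith
  have p2 : 0 < 1 + x := by linarith
  have e : (fun y => weight α β y * (1 - y ^ 2) ^ k) =ᶠ[nhds x]
      fun y => (1 - y) ^ ((k:ℝ) + α) * (1 + y) ^ ((k:ℝ) + β) := by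
    filter_upwards [Ioo_mem_nhds h1 h2] with y hy
    have q1 : 0 < 1 - y := by linarith [hy.2]
    have q2 : 0 < 1 + y := by linarith [hy.1]
    rw [weight, Real.rpow_add q1, Real.rpow_add q2, Real.rpow_natCast, Real.rpow_natCast,
      show 1 - y ^ 2 = (1 - y) * (1 + y) by ring, mul_pow]
    ring
  rw [e.iteratedDeriv_eq k, iteratedDeriv_fun_mul]
  · have d1 : ∀ i, iteratedDeriv i (fun y : ℝ => (1 - y) ^ ((k:ℝ) + α)) x =
        (-1) ^ i * ((descPochhammer ℝ i).eval ((k:ℝ) + α) * (1 - x) ^ ((k:ℝ) + α - i)) := by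
      intro i
      have := congrFun (iteratedDeriv_comp_const_sub (n := i) (f := fun y : ℝ => y ^ ((k:ℝ) + α)) (s := 1)) x
      rw [this]
      simp only [iteratedDeriv_eq_iterate, Real.iter_deriv_rpow_const, smul_eq_mul]
    have d2 : ∀ i, iteratedDeriv i (fun y : ℝ => (1 + y) ^ ((k:ℝ) + β)) x =
        ((descPochhammer ℝ i).eval ((k:ℝ) + β) * (1 + x) ^ ((k:ℝ) + β - i)) := by
      intro i
      have := congrFun (iteratedDeriv_comp_const_add (n := i) (f := fun y : ℝ => y ^ ((k:ℝ) + β)) (s := 1)) x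
      rw [this]
      simp only [iteratedDeriv_eq_iterate, Real.iter_deriv_rpow_const]
    simp only [d1, d2]
    rw [jacobi, Polynomial.eval_finsetSum, Finset.mul_sum, Finset.mul_sum, ← Finset.sum_range_reflect]
    refine Finset.sum_congr rfl fun s hs => ?_
    have hs' : s ≤ k := by simpa [Nat.lt_succ_iff] using hs
    obtain ⟨m, rfl⟩ := Nat.exists_eq_add_of_le hs'
    have i1 : s + m + 1 - 1 - s = m := by omega
    have i2 : s + m - s = m := by omega
    have i3 : s + m - m = s := by omega
    rw [i1, i2, i3]
    have r1 : ((s + m : ℕ) : ℝ) + α - s = m + α := by push_cast; ring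
    have r2 : ((s + m : ℕ) : ℝ) + β - m = s + β := by push_cast; ring
    rw [r1, r2, Real.rpow_add p1, Real.rpow_add p2, Real.rpow_natCast, Real.rpow_natCast,
      choose_eq, choose_eq, weight, Nat.cast_choose ℝ hs', i2]
    simp only [Polynomial.eval_mul, Polynomial.eval_C, Polynomial.eval_pow, Polynomial.eval_sub,
      Polynomial.eval_add, Polynomial.eval_X, Polynomial.eval_one]
    rw [show (1/2 * (x-1)) = (-1) * (1-x) / 2 by ring, show (1/2*(x+1)) = (1+x)/2 by ring]
    have sg : ((-1:ℝ))^(s+m) * (-1)^s = (-1)^m := by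
      rw [pow_add, mul_right_comm, ← mul_pow]; norm_num
    have f1 : ((s + m).factorial : ℝ) ≠ 0 := by positivity
    rw [div_pow, div_pow, mul_pow, ← sg]
    field_simp
    ring_nf
    try simp [pow_mul]
  · exact ContDiffAt.rpow_const_of_ne (by fun_prop) p1.ne'
  · exact ContDiffAt.rpow_const_of_ne (by fun_prop) p2.ne'

/-- The squared norm `h_k` of `P_k^{(α,β)}`. For `k = 0` the factor
`(α + β + 1) Γ(α + β + 1)` is written `Γ(α + β + 2)`, which is its value, by continuity, also at
`α + β + 1 = 0`. -/
def jacobiSqNorm (α β : ℝ) (k : ℕ) : ℝ :=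
  2 ^ (α + β + 1) * Real.Gamma (k + α + 1) * Real.Gamma (k + β + 1) /
    (k.factorial * if k = 0 then Real.Gamma (α + β + 2)
      else (2 * k + α + β + 1) * Real.Gamma (k + α + β + 1))

/-- The normalized Jacobi polynomial of degree `k`, as a function. -/
def normJacobi (α β : ℝ) (k : ℕ) (x : ℝ) : ℝ :=
  (jacobi α β k).eval x / Real.sqrt (jacobiSqNorm α β k)

/-- The projection matrix `B_N = [n^{-1/2} P̃_k(x_j)]`, `1 ≤ j ≤ n`, `0 ≤ k ≤ N`. -/
def projMatrix (α β : ℝ) (N : ℕ) {n : ℕ} (x : Fin n → ℝ) : Matrix (Fin n) (Fin (N + 1)) ℝ :=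
  Matrix.of fun j k => 1 / Real.sqrt n * normJacobi α β k (x j)

/-- The Gram matrix `A_N = B_N' B_N`. -/
def gramMatrix (α β : ℝ) (N : ℕ) {n : ℕ} (x : Fin n → ℝ) :
    Matrix (Fin (N + 1)) (Fin (N + 1)) ℝ :=
  (projMatrix α β N x).transpose * projMatrix α β N x

/-- The 2-norm condition number `κ₂(A) = ‖A‖₂ ‖A⁻¹‖₂` of an invertible matrix. -/
def condNumber {m : ℕ} (A : Matrix (Fin m) (Fin m) ℝ) : ℝ :=
  ‖Matrix.toEuclideanCLM (n := Fin m) (𝕜 := ℝ) A‖ *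
    ‖Matrix.toEuclideanCLM (n := Fin m) (𝕜 := ℝ) A⁻¹‖

/-- The vector of coefficients `Ĉ = (B_N' B_N)⁻¹ B_N' Z_n`, with `Z_n = n^{-1/2} (y_1, …, y_n)'`. -/
def coeffs (α β : ℝ) (N : ℕ) {n : ℕ} (x y : Fin n → ℝ) : Fin (N + 1) → ℝ :=
  ((gramMatrix α β N x)⁻¹).mulVec
    ((projMatrix α β N x).transpose.mulVec fun j => 1 / Real.sqrt n * y j)

/-- The estimator `f̂_{n,N} = ∑ₖ Ĉ_k P̃_k` built from the data `(x_j, y_j)`. -/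
def estimator (α β : ℝ) (N : ℕ) {n : ℕ} (x y : Fin n → ℝ) (t : ℝ) : ℝ :=
  ∑ k : Fin (N + 1), coeffs α β N x y k * normJacobi α β k t

/-- `g` is `c`-bandlimited: `g ∈ L²(ℝ)`, and its (Plancherel) Fourier transform, in the angular
frequency `t = 2πξ`, vanishes almost everywhere outside `[-c, c]`. -/
def IsBandlimited (c : ℝ) (g : ℝ → ℂ) : Prop :=
  ∃ hg : MemLp g 2 (volume : Measure ℝ),
    ∀ᵐ ξ : ℝ, c < |2 * Real.pi * ξ| → (𝓕 (hg.toLp g) : Lp ℂ 2 (volume : Measure ℝ)) ξ = 0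

/-- The rate `η_N^{(α)} = c^{-1/2} C_α (e c / (2N + 2))^{N + 2}`, for the value `C` of `C_α`. -/
def etaRate (C c : ℝ) (N : ℕ) : ℝ :=
  c ^ (-(1 / 2) : ℝ) * C * (Real.exp 1 * c / (2 * N + 2)) ^ (N + 2)

/-- The deviation `((1 / n) log (2 / δ))^{1/4}`. -/
def deviation (n : ℕ) (δ : ℝ) : ℝ := (1 / (n : ℝ) * Real.log (2 / δ)) ^ (1 / 4 : ℝ)

/-- `γ_{α,β}^{-1/2} - 2 ((1 / n) log (2 / δ))^{1/4} ‖f‖_∞ / ‖f‖_ω`. -/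
def denom (α β : ℝ) (f : ℝ → ℝ) (n : ℕ) (δ : ℝ) : ℝ :=
  1 / Real.sqrt (gammaConst α β) - 2 * deviation n δ * (supNorm f / weightedNorm α β f)

end JacobiRegression

end

/-!
Rodrigues' formula and repeated integration by parts make the polynomials `P̃_k` orthonormal, so
least squares reproduces polynomials of degree at most `N`: for such a `q`, the estimator is `q`
plus the least-squares fit to the residuals `y_j - q(x_j)`. This fit has norm at most
`√‖A⁻¹‖ max_j |y_j - q(x_j)|`, and `‖A‖ ≥ A₀₀ = 1 / γ` turns `√‖A⁻¹‖` into `√κ₂(A) √γ`. Hence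
`|f - q| ≤ K` on `I` bounds the error by `√γ K + √κ₂(A) √γ (K + max_j |ε_j|)`.

A bandlimited function agrees almost everywhere with the inverse Fourier integral of its compactly
supported transform, whose derivatives Cauchy–Schwarz bounds by
`|h⁽ᵐ⁾| ≤ cᵐ √c / √(π (2m + 1)) ‖f̄‖₂`. Interpolating `h` at the Chebyshev nodes gives a `q` with
`K = max |h⁽ᴺ⁺¹⁾| / ((N + 1)! 2ᴺ)`, which by Stirling is at most `η_N ‖f̄‖₂` with `C_α = 1`; the
factor `√γ` then makes `C_α = √γ`.

The nodes are almost surely distinct, so `A` is almost surely invertible. For large `n` the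
denominator lies in `(0, 1 / √γ]` and absorbs the remaining `√γ`, so the inequality holds with
probability one.
-/

namespace JacobiRegression

/-! ### Interpolation at Chebyshev nodes -/

theorem eval_iterate_derivative_of_natDegree_le {R : Type*} [CommSemiring R] {k : ℕ}
    {q : Polynomial R} (hq : q.natDegree ≤ k) (x : R) :
    (Polynomial.derivative^[k] q).eval x = k.factorial * q.coeff k := by
  have hdeg : (Polynomial.derivative^[k] q).natDegree ≤ 0 :=
    (Polynomial.natDegree_iterate_derivative q k).trans (by omega)
  rw [Polynomial.eq_C_of_natDegree_le_zero hdeg, Polynomial.eval_C,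
    Polynomial.coeff_iterate_derivative]
  simp [Nat.descFactorial_self]

theorem iteratedDeriv_polynomial_eval {𝕜 : Type*} [NontriviallyNormedField 𝕜] (p : Polynomial 𝕜)
    (n : ℕ) :
    iteratedDeriv n (fun x => p.eval x) = fun x => (Polynomial.derivative^[n] p).eval x := by
  induction n generalizing p with
  | zero => simp
  | succ n ih =>
    rw [iteratedDeriv_succ', Function.iterate_succ_apply, ← ih]
    exact congrArg (iteratedDeriv n) (funext fun x => p.deriv)

theorem iterate_derivative_interpolate_add_nodal {F : Type*} [Field F] [DecidableEq F]
    (s : Finset F) (f : F → F) (K t : F) :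
    (Polynomial.derivative^[s.card] (Lagrange.interpolate s id f +
      Polynomial.C K * Lagrange.nodal s id)).eval t = s.card.factorial * K := by
  have hp : (Lagrange.interpolate s id f).degree < s.card :=
    Lagrange.degree_interpolate_lt f (injOn_id _)
  have hw : (Lagrange.nodal s (id : F → F)).natDegree = s.card := Lagrange.natDegree_nodal
  have hw1 : (Lagrange.nodal s (id : F → F)).coeff s.card = 1 :=
    hw ▸ (Lagrange.nodal_monic : (Lagrange.nodal s (id : F → F)).Monic)
  rw [eval_iterate_derivative_of_natDegree_le, Polynomial.coeff_add, Polynomial.coeff_C_mul, hw1,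
    Polynomial.coeff_eq_zero_of_degree_lt hp, zero_add, mul_one]
  exact Polynomial.natDegree_add_le_of_degree_le (Polynomial.natDegree_le_of_degree_le hp.le)
    ((Polynomial.natDegree_C_mul_le _ _).trans hw.le)

theorem exists_iteratedDeriv_eq_zero {n : ℕ} {g : ℝ → ℝ} (hg : ContDiff ℝ n g) {a b : ℝ}
    {x : Fin (n + 1) → ℝ} (hx : StrictMono x) (hab : ∀ i, x i ∈ Icc a b)
    (h0 : ∀ i, g (x i) = 0) : ∃ ξ ∈ Icc a b, iteratedDeriv n g ξ = 0 := by
  induction n generalizing g with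
  | zero => exact ⟨x 0, hab 0, by simpa using h0 0⟩
  | succ n ih =>
    have rolle (i : Fin (n + 1)) : ∃ y ∈ Ioo (x i.castSucc) (x i.succ), deriv g y = 0 :=
      exists_deriv_eq_zero (hx Fin.castSucc_lt_succ) hg.continuous.continuousOn (by rw [h0, h0])
    choose y hy hy0 using rolle
    have hy_mono : StrictMono y := Fin.strictMono_iff_lt_succ.2 fun i =>
      (hy i.castSucc).2.trans (hy i.succ).1
    obtain ⟨ξ, hξ, h⟩ := ih hg.deriv' hy_mono
      (fun i => ⟨(hab _).1.trans (hy i).1.le, (hy i).2.le.trans (hab _).2⟩) hy0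
    exact ⟨ξ, hξ, by rwa [iteratedDeriv_succ']⟩

theorem exists_sub_interpolate_eq {s : Finset ℝ} {f : ℝ → ℝ} (hf : ContDiff ℝ s.card f) {a b x : ℝ}
    (hs : ∀ t ∈ s, t ∈ Icc a b) (hx : x ∈ Icc a b) :
    ∃ ξ ∈ Icc a b, f x - (Lagrange.interpolate s id f).eval x =
      iteratedDeriv s.card f ξ / s.card.factorial * (Lagrange.nodal s id).eval x := by
  set p := Lagrange.interpolate s id f
  set w := Lagrange.nodal s (id : ℝ → ℝ)
  have hp (t) (ht : t ∈ s) : p.eval t = f t := Lagrange.eval_interpolate_at_node f (injOn_id _) ht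
  have hw (t) (ht : t ∈ s) : w.eval t = 0 :=
    Lagrange.eval_nodal_at_node (v := id) ht
  by_cases hxs : x ∈ s
  · exact ⟨x, hx, by rw [hp x hxs, hw x hxs, sub_self, mul_zero]⟩
  have hwx : w.eval x ≠ 0 := Lagrange.eval_nodal_not_at_node fun i hi h => hxs (h ▸ hi)
  set K := (f x - p.eval x) / w.eval x
  have hK : f x - p.eval x = K * w.eval x := (div_mul_cancel₀ _ hwx).symm
  -- `f - r` vanishes at the `card s + 1` points of `insert x s`.
  set r := p + Polynomial.C K * w with hr
  have hzero (t) (ht : t ∈ insert x s) : f t - r.eval t = 0 := by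
    rw [hr, Polynomial.eval_add, Polynomial.eval_mul, Polynomial.eval_C]
    rcases Finset.mem_insert.1 ht with rfl | ht
    · linarith
    · rw [hp t ht, hw t ht, mul_zero, add_zero, sub_self]
  have hIcc (t) (ht : t ∈ insert x s) : t ∈ Icc a b :=
    (Finset.mem_insert.1 ht).elim (fun h => h ▸ hx) (hs t)
  have hcard : (insert x s).card = s.card + 1 := Finset.card_insert_of_notMem hxs
  have hr_smooth : ContDiff ℝ s.card (fun t => r.eval t) := by
    simpa using r.contDiff_aeval s.card (𝕜 := ℝ) (R := ℝ)
  obtain ⟨ξ, hξ, h⟩ := exists_iteratedDeriv_eq_zero (hf.sub hr_smooth)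
    ((insert x s).orderEmbOfFin hcard).strictMono
    (fun i => hIcc _ ((insert x s).orderEmbOfFin_mem hcard i))
    (fun i => hzero _ ((insert x s).orderEmbOfFin_mem hcard i))
  have hr_deriv : iteratedDeriv s.card (fun t => r.eval t) ξ = s.card.factorial * K := by
    rw [iteratedDeriv_polynomial_eval]
    exact iterate_derivative_interpolate_add_nodal s f K ξ
  rw [← Pi.sub_def, iteratedDeriv_sub hf.contDiffAt hr_smooth.contDiffAt, hr_deriv,
    sub_eq_zero] at h
  exact ⟨ξ, hξ, by rw [hK, h]; field_simp⟩

theorem card_toFinset_roots_chebyshevT (n : ℕ) :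
    (Polynomial.Chebyshev.T ℝ n).roots.toFinset.card = n := by
  rw [Polynomial.Chebyshev.roots_T_real, Finset.val_toFinset, Finset.card_image_of_injOn,
    Finset.card_range]
  exact (Finset.range n).nodup_map_iff_injOn.1 (Polynomial.Chebyshev.roots_T_real_nodup n)

theorem chebyshevT_eq_C_mul_nodal (n : ℕ) :
    Polynomial.Chebyshev.T ℝ n = Polynomial.C (2 ^ (n - 1)) *
      Lagrange.nodal (Polynomial.Chebyshev.T ℝ n).roots.toFinset id := by
  have hroots : (Polynomial.Chebyshev.T ℝ n).roots =
      (Polynomial.Chebyshev.T ℝ n).roots.toFinset.val := by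
    rw [Polynomial.Chebyshev.roots_T_real, Finset.val_toFinset]
  have hcard : (Polynomial.Chebyshev.T ℝ n).roots.card =
      (Polynomial.Chebyshev.T ℝ n).natDegree := by
    rw [hroots, Finset.card_val, card_toFinset_roots_chebyshevT, Polynomial.Chebyshev.natDegree_T,
      Int.natAbs_natCast]
  conv_lhs => rw [← Polynomial.C_leadingCoeff_mul_prod_multiset_X_sub_C hcard]
  rw [Polynomial.Chebyshev.leadingCoeff_T, Int.natAbs_natCast, Lagrange.nodal_eq]
  conv_lhs => rw [hroots]
  rfl

theorem exists_polynomial_abs_sub_le {f : ℝ → ℝ} (N : ℕ) (hf : ContDiff ℝ (N + 1 : ℕ) f) {M : ℝ}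
    (hM : ∀ t ∈ Icc (-1 : ℝ) 1, |iteratedDeriv (N + 1) f t| ≤ M) :
    ∃ q : Polynomial ℝ, q.natDegree ≤ N ∧
      ∀ x ∈ Icc (-1 : ℝ) 1, |f x - q.eval x| ≤ M / ((N + 1).factorial * 2 ^ N) := by
  set s := (Polynomial.Chebyshev.T ℝ (N + 1 : ℕ)).roots.toFinset
  have hcard : s.card = N + 1 := card_toFinset_roots_chebyshevT (N + 1)
  have hs (t) (ht : t ∈ s) : t ∈ Icc (-1 : ℝ) 1 := by
    have h0 : (Polynomial.Chebyshev.T ℝ (N + 1 : ℕ)).eval t = 0 :=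
      Polynomial.isRoot_of_mem_roots (Multiset.mem_toFinset.1 ht)
    exact abs_le.1 ((Polynomial.Chebyshev.abs_eval_T_real_le_one_iff (n := (N + 1 : ℕ))
      (by omega) t).2 (by rw [h0, abs_zero]; exact zero_le_one))
  refine ⟨Lagrange.interpolate s id f, ?_, fun x hx => ?_⟩
  · have hdeg := Lagrange.degree_interpolate_lt (s := s) f (injOn_id _)
    rw [hcard] at hdeg
    exact Polynomial.natDegree_le_iff_coeff_eq_zero.2
      ((Polynomial.degree_lt_iff_coeff_zero _ _).1 hdeg)
  obtain ⟨ξ, hξ, h⟩ := exists_sub_interpolate_eq (hcard ▸ hf) hs hx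
  have hw : |(Lagrange.nodal s id).eval x| ≤ 1 / 2 ^ N := by
    have hT := Polynomial.Chebyshev.abs_eval_T_real_le_one (N + 1 : ℕ) (abs_le.2 hx)
    rw [chebyshevT_eq_C_mul_nodal, Polynomial.eval_mul, Polynomial.eval_C, abs_mul,
      Nat.add_sub_cancel, abs_of_pos (by positivity)] at hT
    rwa [le_div_iff₀' (by positivity)]
  rw [h, hcard, abs_mul, abs_div, Nat.abs_cast, ← div_div, div_eq_mul_one_div (M / _)]
  have hMξ := hM ξ hξ
  have hM0 : 0 ≤ M := (abs_nonneg _).trans hMξ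
  gcongr

/-! ### Jacobi polynomials -/

section Weight

variable {α β : ℝ}

theorem ofReal_rpow_mul_one_sub_rpow (u v : ℝ) {t : ℝ} (ht : t ∈ Icc (0 : ℝ) 1) :
    ((t ^ u * (1 - t) ^ v : ℝ) : ℂ) =
      (t : ℂ) ^ (((u + 1 : ℝ) : ℂ) - 1) * (1 - (t : ℂ)) ^ (((v + 1 : ℝ) : ℂ) - 1) := by
  rw [Complex.ofReal_mul, Complex.ofReal_cpow ht.1, Complex.ofReal_cpow (sub_nonneg.2 ht.2)]
  push_cast
  simp only [add_sub_cancel_right]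

theorem intervalIntegrable_rpow_mul_one_sub_rpow {u v : ℝ} (hu : -1 < u) (hv : -1 < v) :
    IntervalIntegrable (fun t : ℝ => t ^ u * (1 - t) ^ v) volume 0 1 := by
  have h := Complex.betaIntegral_convergent (u := ((u + 1 : ℝ) : ℂ)) (v := ((v + 1 : ℝ) : ℂ))
    (by rw [Complex.ofReal_re]; linarith) (by rw [Complex.ofReal_re]; linarith)
  rw [intervalIntegrable_iff, uIoc_of_le zero_le_one] at h ⊢
  refine h.re.congr <| (ae_restrict_mem measurableSet_Ioc).mono fun t ht => ?_
  simp only [← ofReal_rpow_mul_one_sub_rpow u v (Ioc_subset_Icc_self ht)]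
  exact Complex.ofReal_re _

theorem integral_rpow_mul_one_sub_rpow {u v : ℝ} (hu : -1 < u) (hv : -1 < v) :
    ∫ t in (0 : ℝ)..1, t ^ u * (1 - t) ^ v = ProbabilityTheory.beta (u + 1) (v + 1) := by
  rw [ProbabilityTheory.beta_eq_betaIntegralReal _ _ (by linarith) (by linarith),
    Complex.betaIntegral, ← intervalIntegral.integral_congr (fun t ht =>
      ofReal_rpow_mul_one_sub_rpow u v (uIcc_of_le (zero_le_one' ℝ) ▸ ht)),
    intervalIntegral.integral_ofReal, Complex.ofReal_re]

theorem weight_nonneg (α β : ℝ) {x : ℝ} (hx : x ∈ Icc (-1 : ℝ) 1) : 0 ≤ weight α β x :=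
  mul_nonneg (Real.rpow_nonneg (by linarith [hx.2]) _) (Real.rpow_nonneg (by linarith [hx.1]) _)

theorem measurable_weight (α β : ℝ) : Measurable (weight α β) := by
  unfold weight
  fun_prop

theorem continuous_weight (hα : 0 ≤ α) (hβ : 0 ≤ β) : Continuous (weight α β) :=
  ((continuous_const.sub continuous_id).rpow_const fun _ => Or.inr hα).mul
    ((continuous_const.add continuous_id).rpow_const fun _ => Or.inr hβ)

theorem weight_two_mul_sub_one (α β : ℝ) {t : ℝ} (ht : t ∈ Icc (0 : ℝ) 1) :
    weight α β (2 * t - 1) = 2 ^ (α + β) * (t ^ β * (1 - t) ^ α) := by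
  have h1 : 1 - (2 * t - 1) = 2 * (1 - t) := by ring
  have h2 : 1 + (2 * t - 1) = 2 * t := by ring
  rw [weight, h1, h2, Real.mul_rpow two_pos.le (sub_nonneg.2 ht.2), Real.mul_rpow two_pos.le ht.1,
    Real.rpow_add two_pos]
  ring

theorem intervalIntegrable_weight (hα : -1 < α) (hβ : -1 < β) :
    IntervalIntegrable (weight α β) volume (-1) 1 := by
  have h : IntervalIntegrable (fun t => weight α β (2 * t - 1)) volume 0 1 := by
    refine ((intervalIntegrable_rpow_mul_one_sub_rpow hβ hα).const_mul (2 ^ (α + β))).congr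
      fun t ht => ?_
    rw [uIoc_of_le zero_le_one] at ht
    exact (weight_two_mul_sub_one α β (Ioc_subset_Icc_self ht)).symm
  convert (h.comp_mul_left (c := 1 / 2)).comp_add_right 1 using 2 <;> ring_nf

theorem integral_weight (hα : -1 < α) (hβ : -1 < β) :
    ∫ y in (-1 : ℝ)..1, weight α β y = gammaConst α β := by
  calc ∫ y in (-1 : ℝ)..1, weight α β y
      = 2 * ∫ t in (0 : ℝ)..1, weight α β (2 * t - 1) := by
        rw [intervalIntegral.mul_integral_comp_mul_sub]
        norm_num
    _ = 2 * ∫ t in (0 : ℝ)..1, 2 ^ (α + β) * (t ^ β * (1 - t) ^ α) := by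
        congr 1
        exact intervalIntegral.integral_congr fun t ht =>
          weight_two_mul_sub_one α β (uIcc_of_le (zero_le_one' ℝ) ▸ ht)
    _ = gammaConst α β := by
        rw [intervalIntegral.integral_const_mul, integral_rpow_mul_one_sub_rpow hβ hα, gammaConst,
          Real.rpow_add_one two_ne_zero, ProbabilityTheory.beta, ProbabilityTheory.beta,
          add_comm (β + 1)]
        ring

theorem gammaConst_pos (hα : -1 < α) (hβ : -1 < β) : 0 < gammaConst α β :=
  mul_pos (ProbabilityTheory.beta_pos (by linarith) (by linarith)) (by positivity)

end Weight

section JacobiPolynomials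

variable {α β : ℝ}

theorem weight_mul_one_sub_sq_pow_succ (α β : ℝ) (k : ℕ) {x : ℝ} (hx : x ∈ Ioo (-1 : ℝ) 1) :
    weight α β x * (1 - x ^ 2) ^ (k + 1) = weight (α + 1) (β + 1) x * (1 - x ^ 2) ^ k := by
  have h1 : 1 - x ≠ 0 := by linarith [hx.2]
  have h2 : 1 + x ≠ 0 := by linarith [hx.1]
  rw [weight, weight, Real.rpow_add_one h1, Real.rpow_add_one h2]
  ring

theorem differentiableAt_weight (α β : ℝ) {x : ℝ} (hx : x ∈ Ioo (-1 : ℝ) 1) :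
    DifferentiableAt ℝ (weight α β) x := by
  have h1 : 1 - x ≠ 0 := by linarith [hx.2]
  have h2 : 1 + x ≠ 0 := by linarith [hx.1]
  exact DifferentiableAt.mul (.rpow_const (by fun_prop) (.inl h1))
    (.rpow_const (by fun_prop) (.inl h2))

theorem hasDerivAt_weight_mul_jacobi (α β : ℝ) (k : ℕ) {x : ℝ} (hx : x ∈ Ioo (-1 : ℝ) 1) :
    HasDerivAt (fun y => weight (α + 1) (β + 1) y * (jacobi (α + 1) (β + 1) k).eval y)
      (-(2 * (k + 1)) * (weight α β x * (jacobi α β (k + 1)).eval x)) x := by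
  set F : ℝ → ℝ := fun y => weight α β y * (1 - y ^ 2) ^ (k + 1)
  set W : ℝ → ℝ := fun y => weight (α + 1) (β + 1) y * (jacobi (α + 1) (β + 1) k).eval y
  have hW : W =ᶠ[nhds x] fun y => (-1) ^ k / (2 ^ k * k.factorial) * iteratedDeriv k F y := by
    filter_upwards [Ioo_mem_nhds hx.1 hx.2] with y hy
    have hF : F =ᶠ[nhds y] fun z => weight (α + 1) (β + 1) z * (1 - z ^ 2) ^ k :=
      Filter.eventuallyEq_of_mem (Ioo_mem_nhds hy.1 hy.2) fun z hz =>
        weight_mul_one_sub_sq_pow_succ α β k hz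
    rw [hF.iteratedDeriv_eq k]
    exact weight_mul_jacobi (α + 1) (β + 1) k hy
  have hd : DifferentiableAt ℝ W x :=
    (differentiableAt_weight _ _ hx).mul (Polynomial.differentiableAt _)
  have hderiv : deriv W x = -(2 * (k + 1)) * (weight α β x * (jacobi α β (k + 1)).eval x) := by
    rw [hW.deriv_eq, deriv_const_mul_field, weight_mul_jacobi α β (k + 1) hx, iteratedDeriv_succ,
      Nat.factorial_succ]
    push_cast
    field_simp
    ring
  exact hderiv ▸ hd.hasDerivAt

theorem integral_weight_mul_jacobi_succ (hα : -1 < α) (hβ : -1 < β) (k : ℕ) (q : Polynomial ℝ) :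
    ∫ x in (-1 : ℝ)..1, weight α β x * ((jacobi α β (k + 1)).eval x * q.eval x) =
      1 / (2 * (k + 1)) * ∫ x in (-1 : ℝ)..1, weight (α + 1) (β + 1) x *
        ((jacobi (α + 1) (β + 1) k).eval x * q.derivative.eval x) := by
  have hW : Continuous (weight (α + 1) (β + 1)) := continuous_weight (by linarith) (by linarith)
  have hW1 : weight (α + 1) (β + 1) 1 = 0 := by
    simp [weight, Real.zero_rpow (by linarith : α + 1 ≠ 0)]
  have hW2 : weight (α + 1) (β + 1) (-1) = 0 := by
    simp [weight, Real.zero_rpow (by linarith : β + 1 ≠ 0)]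
  have parts := intervalIntegral.integral_mul_deriv_eq_deriv_mul_of_hasDerivAt
    (a := (-1 : ℝ)) (b := 1) (u := fun x => q.eval x) (u' := fun x => q.derivative.eval x)
    (v := fun x => weight (α + 1) (β + 1) x * (jacobi (α + 1) (β + 1) k).eval x)
    (v' := fun x => -(2 * ((k : ℝ) + 1)) * (weight α β x * (jacobi α β (k + 1)).eval x))
    (by fun_prop) (by fun_prop) (fun x _ => q.hasDerivAt x)
    (fun x hx => hasDerivAt_weight_mul_jacobi α β k (by simpa using hx))
    ((Polynomial.continuous _).intervalIntegrable _ _)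
    (((intervalIntegrable_weight hα hβ).mul_continuousOn (by fun_prop)).const_mul _)
  simp only [hW1, hW2, zero_mul, mul_zero, sub_self, zero_sub] at parts
  rw [one_div, eq_inv_mul_iff_mul_eq₀ (by positivity), ← neg_inj,
    ← intervalIntegral.integral_const_mul, ← intervalIntegral.integral_neg]
  refine (intervalIntegral.integral_congr fun x _ => ?_).trans
    (parts.trans (congrArg Neg.neg (intervalIntegral.integral_congr fun x _ => ?_))) <;> ring

theorem integral_weight_mul_jacobi (hα : -1 < α) (hβ : -1 < β) (k : ℕ) (q : Polynomial ℝ) :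
    ∫ x in (-1 : ℝ)..1, weight α β x * ((jacobi α β k).eval x * q.eval x) =
      1 / (2 ^ k * k.factorial) * ∫ x in (-1 : ℝ)..1, weight (α + k) (β + k) x *
        (Polynomial.derivative^[k] q).eval x := by
  induction k generalizing α β q with
  | zero => simp [jacobi]
  | succ k ih =>
    rw [integral_weight_mul_jacobi_succ hα hβ, ih (by linarith) (by linarith),
      Function.iterate_succ_apply, Nat.factorial_succ, ← mul_assoc]
    push_cast
    rw [add_right_comm α, add_right_comm β, ← add_assoc, ← add_assoc]
    congr 1
    field_simp
    ring

theorem monic_X_sub_one_pow_mul_X_add_one_pow (s m : ℕ) :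
    (((Polynomial.X - 1) ^ s * (Polynomial.X + 1) ^ m : Polynomial ℝ)).Monic :=
  ((Polynomial.monic_X_sub_C 1).pow s).mul ((Polynomial.monic_X_add_C 1).pow m)

theorem natDegree_X_sub_one_pow_mul_X_add_one_pow (s m : ℕ) :
    (((Polynomial.X - 1) ^ s * (Polynomial.X + 1) ^ m : Polynomial ℝ)).natDegree = s + m := by
  have h1 : (Polynomial.X - 1 : Polynomial ℝ).Monic := Polynomial.monic_X_sub_C 1
  have h2 : (Polynomial.X + 1 : Polynomial ℝ).Monic := Polynomial.monic_X_add_C 1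
  have e1 : (Polynomial.X - 1 : Polynomial ℝ).natDegree = 1 := Polynomial.natDegree_X_sub_C 1
  have e2 : (Polynomial.X + 1 : Polynomial ℝ).natDegree = 1 := Polynomial.natDegree_X_add_C 1
  rw [(h1.pow s).natDegree_mul (h2.pow m), h1.natDegree_pow, h2.natDegree_pow, e1, e2, mul_one,
    mul_one]

theorem jacobi_eq_sum (α β : ℝ) (k : ℕ) :
    jacobi α β k = ∑ s ∈ Finset.range (k + 1),
      Polynomial.C (Ring.choose ((k : ℝ) + α) (k - s) * Ring.choose ((k : ℝ) + β) s / 2 ^ k) *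
        ((Polynomial.X - 1) ^ s * (Polynomial.X + 1) ^ (k - s)) := by
  refine Finset.sum_congr rfl fun s hs => ?_
  have hk : s + (k - s) = k := Nat.add_sub_cancel' (Nat.lt_succ_iff.1 (Finset.mem_range.1 hs))
  have h2 : (1 / 2 : ℝ) ^ s * (1 / 2) ^ (k - s) = 1 / 2 ^ k := by rw [← pow_add, hk, one_div_pow]
  rw [div_eq_mul_one_div _ ((2 : ℝ) ^ k), ← h2, mul_pow, mul_pow]
  simp only [Polynomial.C_mul, Polynomial.C_pow]
  ring

theorem natDegree_jacobi_le (α β : ℝ) (k : ℕ) : (jacobi α β k).natDegree ≤ k := by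
  rw [jacobi_eq_sum]
  refine Polynomial.natDegree_sum_le_of_forall_le _ _ fun s hs =>
    (Polynomial.natDegree_C_mul_le _ _).trans ?_
  rw [natDegree_X_sub_one_pow_mul_X_add_one_pow]
  have := Finset.mem_range.1 hs
  omega

-- The leading coefficient is summed by the Chu–Vandermonde identity.
theorem coeff_jacobi (α β : ℝ) (k : ℕ) :
    (jacobi α β k).coeff k = Ring.choose (2 * (k : ℝ) + α + β) k / 2 ^ k := by
  have vandermonde : Ring.choose (2 * (k : ℝ) + α + β) k = ∑ s ∈ Finset.range (k + 1),
      Ring.choose ((k : ℝ) + α) (k - s) * Ring.choose ((k : ℝ) + β) s := by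
    rw [show 2 * (k : ℝ) + α + β = ((k : ℝ) + β) + ((k : ℝ) + α) by ring,
      Ring.add_choose_eq k (Commute.all _ _), Finset.Nat.sum_antidiagonal_eq_sum_range_succ
        (fun i j => Ring.choose ((k : ℝ) + β) i * Ring.choose ((k : ℝ) + α) j)]
    exact Finset.sum_congr rfl fun s _ => mul_comm _ _
  rw [vandermonde, jacobi_eq_sum, Polynomial.finsetSum_coeff, Finset.sum_div]
  refine Finset.sum_congr rfl fun s hs => ?_
  have hk : s + (k - s) = k := Nat.add_sub_cancel' (Nat.lt_succ_iff.1 (Finset.mem_range.1 hs))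
  have hmonic := monic_X_sub_one_pow_mul_X_add_one_pow s (k - s)
  rw [Polynomial.Monic, Polynomial.leadingCoeff, natDegree_X_sub_one_pow_mul_X_add_one_pow,
    hk] at hmonic
  rw [Polynomial.coeff_C_mul, hmonic, mul_one]

theorem Gamma_add_natCast {s : ℝ} (hs : 0 < s) (m : ℕ) :
    Real.Gamma (s + m) = (ascPochhammer ℝ m).eval s * Real.Gamma s := by
  induction m with
  | zero => simp
  | succ m ih =>
    rw [Nat.cast_succ, ← add_assoc, Real.Gamma_add_one (by positivity), ih,
      ascPochhammer_succ_eval]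
    ring

theorem integral_weight_mul_jacobi_sq (hα : -1 < α) (hβ : -1 < β) (k : ℕ) :
    ∫ x in (-1 : ℝ)..1, weight α β x * ((jacobi α β k).eval x * (jacobi α β k).eval x) =
      Ring.choose (2 * (k : ℝ) + α + β) k / (2 ^ k * 2 ^ k) * gammaConst (α + k) (β + k) := by
  rw [integral_weight_mul_jacobi hα hβ]
  simp only [eval_iterate_derivative_of_natDegree_le (natDegree_jacobi_le α β k)]
  have : (0 : ℝ) ≤ k := k.cast_nonneg
  rw [intervalIntegral.integral_mul_const, integral_weight (by linarith) (by linarith),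
    coeff_jacobi]
  field_simp

theorem jacobiSqNorm_zero (α β : ℝ) : jacobiSqNorm α β 0 = gammaConst α β := by
  rw [jacobiSqNorm, gammaConst, ProbabilityTheory.beta]
  simp
  ring_nf

theorem jacobiSqNorm_eq (hα : -1 < α) (hβ : -1 < β) (k : ℕ) :
    jacobiSqNorm α β k =
      Ring.choose (2 * (k : ℝ) + α + β) k / (2 ^ k * 2 ^ k) * gammaConst (α + k) (β + k) := by
  rcases Nat.eq_zero_or_pos k with rfl | hk
  · simp [jacobiSqNorm_zero]
  have hk1 : (1 : ℝ) ≤ k := Nat.one_le_cast.2 hk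
  have hs : 0 < k + α + β + 1 := by linarith
  have gamma_rec : Real.Gamma (2 * k + α + β + 2) =
      (2 * k + α + β + 1) * ((ascPochhammer ℝ k).eval (k + α + β + 1) *
        Real.Gamma (k + α + β + 1)) := by
    rw [← Gamma_add_natCast hs, show k + α + β + 1 + k = 2 * (k : ℝ) + α + β + 1 by ring,
      ← Real.Gamma_add_one (by linarith)]
    ring_nf
  have choose_k : Ring.choose (2 * (k : ℝ) + α + β) k =
      (ascPochhammer ℝ k).eval (k + α + β + 1) / k.factorial := by
    rw [choose_eq, descPochhammer_eval_eq_ascPochhammer]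
    ring_nf
  have two_pow : (2 : ℝ) ^ (α + k + (β + k) + 1) = 2 ^ (α + β + 1) * (2 ^ k * 2 ^ k) := by
    rw [show α + k + (β + k) + 1 = α + β + 1 + k + k by ring, Real.rpow_add two_pos,
      Real.rpow_add two_pos, Real.rpow_natCast, mul_assoc]
  rw [jacobiSqNorm, if_neg hk.ne', gammaConst, ProbabilityTheory.beta, two_pow, choose_k,
    show α + k + 1 + (β + k + 1) = 2 * k + α + β + 2 by ring, gamma_rec,
    add_comm α k, add_comm β k]
  have hasc := (ascPochhammer_pos k _ hs).ne'
  have hΓ := (Real.Gamma_pos_of_pos hs).ne'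
  have : 2 * (k : ℝ) + α + β + 1 ≠ 0 := by linarith
  field_simp

theorem jacobiSqNorm_pos (hα : -1 < α) (hβ : -1 < β) (k : ℕ) : 0 < jacobiSqNorm α β k := by
  have : (0 : ℝ) ≤ k := k.cast_nonneg
  rw [jacobiSqNorm]
  refine div_pos (mul_pos (mul_pos (by positivity) (Real.Gamma_pos_of_pos (by linarith)))
    (Real.Gamma_pos_of_pos (by linarith))) (mul_pos (by positivity) ?_)
  split_ifs with h
  · exact Real.Gamma_pos_of_pos (by linarith)
  · have hk1 : (1 : ℝ) ≤ k := Nat.one_le_cast.2 (Nat.pos_of_ne_zero h)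
    exact mul_pos (by linarith) (Real.Gamma_pos_of_pos (by linarith))

theorem integral_weight_mul_jacobi_of_lt (hα : -1 < α) (hβ : -1 < β) {j k : ℕ} (h : j < k) :
    ∫ x in (-1 : ℝ)..1, weight α β x * ((jacobi α β k).eval x * (jacobi α β j).eval x) = 0 := by
  rw [integral_weight_mul_jacobi hα hβ,
    Polynomial.iterate_derivative_eq_zero ((natDegree_jacobi_le α β j).trans_lt h)]
  simp

theorem integral_weight_mul_normJacobi (hα : -1 < α) (hβ : -1 < β) (j k : ℕ) :
    ∫ x in (-1 : ℝ)..1, weight α β x * (normJacobi α β j x * normJacobi α β k x) =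
      if j = k then 1 else 0 := by
  have factor (x : ℝ) : weight α β x * (normJacobi α β j x * normJacobi α β k x) =
      1 / (Real.sqrt (jacobiSqNorm α β j) * Real.sqrt (jacobiSqNorm α β k)) *
        (weight α β x * ((jacobi α β j).eval x * (jacobi α β k).eval x)) := by
    simp only [normJacobi]
    ring
  simp only [factor, intervalIntegral.integral_const_mul]
  rcases lt_trichotomy j k with h | rfl | h
  · simp only [mul_comm (Polynomial.eval _ (jacobi α β j))]
    rw [integral_weight_mul_jacobi_of_lt hα hβ h, mul_zero, if_neg h.ne]
  · have hpos := jacobiSqNorm_pos hα hβ j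
    rw [integral_weight_mul_jacobi_sq hα hβ, ← jacobiSqNorm_eq hα hβ, Real.mul_self_sqrt hpos.le,
      if_pos rfl, one_div_mul_cancel hpos.ne']
  · rw [integral_weight_mul_jacobi_of_lt hα hβ h, mul_zero, if_neg h.ne']

theorem normJacobi_zero (α β x : ℝ) : normJacobi α β 0 x = 1 / Real.sqrt (gammaConst α β) := by
  simp [normJacobi, jacobiSqNorm_zero, jacobi]

theorem continuous_normJacobi (α β : ℝ) (k : ℕ) : Continuous (normJacobi α β k) :=
  (Polynomial.continuous _).div_const _

theorem degree_jacobi (hα : -1 < α) (hβ : -1 < β) (k : ℕ) : (jacobi α β k).degree = k := by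
  have hcoeff : (jacobi α β k).coeff k ≠ 0 := fun h => by
    have hpos := jacobiSqNorm_pos hα hβ k
    rw [coeff_jacobi, div_eq_zero_iff, or_iff_left (by positivity)] at h
    simp [jacobiSqNorm_eq hα hβ, h] at hpos
  exact le_antisymm (Polynomial.degree_le_of_natDegree_le (natDegree_jacobi_le α β k))
    (Polynomial.le_degree_of_ne_zero hcoeff)

/-- The normalized Jacobi polynomials `P̃_k` as polynomials, bundled with the fact that `P̃_k` has
degree `k`: they span the polynomials of bounded degree and are linearly independent. -/
noncomputable def normJacobiSequence (hα : -1 < α) (hβ : -1 < β) : Polynomial.Sequence ℝ where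
  elems' k := Polynomial.C (1 / Real.sqrt (jacobiSqNorm α β k)) * jacobi α β k
  degree_eq' k := by
    rw [Polynomial.degree_C_mul, degree_jacobi hα hβ]
    exact (one_div_pos.2 (Real.sqrt_pos.2 (jacobiSqNorm_pos hα hβ k))).ne'

theorem eval_normJacobiSequence (hα : -1 < α) (hβ : -1 < β) (k : ℕ) (x : ℝ) :
    (normJacobiSequence hα hβ k).eval x = normJacobi α β k x := by
  change (Polynomial.C _ * jacobi α β k).eval x = _
  rw [Polynomial.eval_mul, Polynomial.eval_C, normJacobi, one_div_mul_eq_div]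

theorem eval_sum_smul_normJacobiSequence (hα : -1 < α) (hβ : -1 < β) {N : ℕ}
    (v : Fin (N + 1) → ℝ) (x : ℝ) :
    (∑ k : Fin (N + 1), v k • normJacobiSequence hα hβ k).eval x =
      ∑ k : Fin (N + 1), v k * normJacobi α β k x := by
  simp only [Polynomial.eval_finsetSum, Polynomial.eval_smul, eval_normJacobiSequence, smul_eq_mul]

end JacobiPolynomials

theorem exists_sum_smul_eq_of_natDegree_le {F : Type*} [Field F] (S : Polynomial.Sequence F)
    {N : ℕ} {q : Polynomial F} (hq : q.natDegree ≤ N) :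
    ∃ d : Fin (N + 1) → F, ∑ k : Fin (N + 1), d k • S k = q := by
  have hrange : range (fun k : Fin (N + 1) => S k) = S '' Iic N := by
    ext p
    simp only [mem_range, mem_image, mem_Iic, ← Nat.lt_succ_iff]
    exact Fin.exists_iff.trans (by simp)
  rw [← Submodule.mem_span_range_iff_exists_fun, hrange,
    S.span_degreeLE fun i _ => (Polynomial.leadingCoeff_ne_zero.2 (S.ne_zero i)).isUnit]
  exact Polynomial.mem_degreeLE.2 (Polynomial.degree_le_of_natDegree_le hq)

theorem natDegree_sum_smul_le {F : Type*} [Field F] (S : Polynomial.Sequence F) {N : ℕ}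
    (v : Fin (N + 1) → F) : (∑ k : Fin (N + 1), v k • S k).natDegree ≤ N :=
  Polynomial.natDegree_sum_le_of_forall_le _ _ fun k _ =>
    (Polynomial.natDegree_smul_le _ _).trans ((S.natDegree_eq k).trans_le (Nat.lt_succ_iff.1 k.2))

/-! ### The weighted norm -/

section WeightedNorm

variable {α β : ℝ}

theorem weightMeasure_absolutelyContinuous (α β : ℝ) :
    weightMeasure α β ≪ volume.restrict (Icc (-1 : ℝ) 1) :=
  withDensity_absolutelyContinuous _ _

theorem ae_weightMeasure_mem_Icc (α β : ℝ) :
    ∀ᵐ x ∂(weightMeasure α β), x ∈ Icc (-1 : ℝ) 1 :=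
  (weightMeasure_absolutelyContinuous α β).ae_le (ae_restrict_mem measurableSet_Icc)

theorem weightMeasure_univ (hα : -1 < α) (hβ : -1 < β) :
    weightMeasure α β univ = ENNReal.ofReal (gammaConst α β) := by
  have hint : IntegrableOn (weight α β) (Icc (-1) 1) := by
    rw [integrableOn_Icc_iff_integrableOn_Ioc,
      ← intervalIntegrable_iff_integrableOn_Ioc_of_le (by norm_num)]
    exact intervalIntegrable_weight hα hβ
  rw [weightMeasure, withDensity_apply _ MeasurableSet.univ, Measure.restrict_univ,
    ← ofReal_integral_eq_lintegral_ofReal hint, ← integral_weight hα hβ,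
    intervalIntegral.integral_of_le (by norm_num), integral_Icc_eq_integral_Ioc]
  filter_upwards [ae_restrict_mem measurableSet_Icc] with x hx using weight_nonneg α β hx

theorem isFiniteMeasure_weightMeasure (hα : -1 < α) (hβ : -1 < β) :
    IsFiniteMeasure (weightMeasure α β) :=
  ⟨by rw [weightMeasure_univ hα hβ]; exact ENNReal.ofReal_lt_top⟩

theorem integral_weightMeasure (α β : ℝ) (g : ℝ → ℝ) :
    ∫ x, g x ∂(weightMeasure α β) = ∫ x in (-1 : ℝ)..1, weight α β x * g x := by
  rw [weightMeasure, integral_withDensity_eq_integral_toReal_smul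
    (measurable_weight α β).ennreal_ofReal (by simp), intervalIntegral.integral_of_le (by norm_num),
    ← integral_Icc_eq_integral_Ioc]
  refine setIntegral_congr_fun measurableSet_Icc fun x hx => ?_
  rw [ENNReal.toReal_ofReal (weight_nonneg α β hx), smul_eq_mul]

theorem memLp_weightMeasure_of_continuous (hα : -1 < α) (hβ : -1 < β) {g : ℝ → ℝ}
    (hg : Continuous g) : MemLp g 2 (weightMeasure α β) := by
  have := isFiniteMeasure_weightMeasure hα hβ
  obtain ⟨K, hK⟩ := isCompact_Icc.exists_bound_of_continuousOn
    (hg.continuousOn (s := Icc (-1 : ℝ) 1))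
  refine MemLp.of_bound hg.aestronglyMeasurable K ?_
  filter_upwards [ae_weightMeasure_mem_Icc α β] with x hx using hK x hx

theorem weightedNorm_le_of_ae_bound (hα : -1 < α) (hβ : -1 < β) {g : ℝ → ℝ} {K : ℝ} (hK : 0 ≤ K)
    (hg : ∀ᵐ x ∂(weightMeasure α β), |g x| ≤ K) :
    weightedNorm α β g ≤ Real.sqrt (gammaConst α β) * K := by
  have h : eLpNorm g 2 (weightMeasure α β) ≤
      (weightMeasure α β univ) ^ (2 : ℝ≥0∞).toReal⁻¹ * ENNReal.ofReal K :=
    eLpNorm_le_of_ae_bound hg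
  rw [weightMeasure_univ hα hβ] at h
  have h2 := ENNReal.toReal_mono (by finiteness) h
  rw [ENNReal.toReal_mul, ← ENNReal.toReal_rpow, ENNReal.toReal_ofReal hK,
    ENNReal.toReal_ofReal (gammaConst_pos hα hβ).le] at h2
  rw [Real.sqrt_eq_rpow]
  simpa [weightedNorm] using h2

theorem weightedNorm_sub_le {g₁ g₂ : ℝ → ℝ} (h₁ : MemLp g₁ 2 (weightMeasure α β))
    (h₂ : MemLp g₂ 2 (weightMeasure α β)) :
    weightedNorm α β (g₁ - g₂) ≤ weightedNorm α β g₁ + weightedNorm α β g₂ := by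
  rw [weightedNorm, weightedNorm, weightedNorm, ← ENNReal.toReal_add h₁.2.ne h₂.2.ne]
  exact ENNReal.toReal_mono (ENNReal.add_ne_top.2 ⟨h₁.2.ne, h₂.2.ne⟩)
    (eLpNorm_sub_le h₁.1 h₂.1 (by norm_num))

theorem toReal_eLpNorm_sum_mul_of_orthonormal {Ω ι : Type*} [MeasurableSpace Ω] {μ : Measure Ω}
    [Fintype ι] [DecidableEq ι] {e : ι → Ω → ℝ} (he : ∀ i, MemLp (e i) 2 μ)
    (ho : ∀ i j, ∫ x, e i x * e j x ∂μ = if i = j then 1 else 0) (v : ι → ℝ) :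
    (eLpNorm (fun x => ∑ i, v i * e i x) 2 μ).toReal =
      ‖(WithLp.toLp 2 v : EuclideanSpace ℝ ι)‖ := by
  set E : ι → Lp ℝ 2 μ := fun i => (he i).toLp (e i)
  have hE : Orthonormal ℝ E := by
    refine orthonormal_iff_ite.2 fun i j => ?_
    rw [L2.inner_def, ← ho i j]
    refine integral_congr_ae ?_
    filter_upwards [(he i).coeFn_toLp, (he j).coeFn_toLp] with x hi hj
    rw [Real.inner_apply, hi, hj]
  have hsum : ⇑(∑ i, v i • E i) =ᵐ[μ] fun x => ∑ i, v i * e i x := by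
    have hcoe : ∀ᵐ x ∂μ, ∀ i, (v i • E i : Lp ℝ 2 μ) x = v i * e i x := ae_all_iff.2 fun i => by
      filter_upwards [Lp.coeFn_smul (v i) (E i), (he i).coeFn_toLp] with x h1 h2
      rw [h1, Pi.smul_apply, h2, smul_eq_mul]
    filter_upwards [Lp.coeFn_finsetSum Finset.univ fun i => v i • E i, hcoe] with x h1 h2
    rw [h1, Finset.sum_apply]
    exact Finset.sum_congr rfl fun i _ => h2 i
  rw [← eLpNorm_congr_ae hsum, ← Lp.norm_def, norm_eq_sqrt_real_inner (F := Lp ℝ 2 μ),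
    hE.inner_sum, EuclideanSpace.norm_eq]
  simp [sq]

theorem weightedNorm_sum_normJacobi (hα : -1 < α) (hβ : -1 < β) {N : ℕ} (v : Fin (N + 1) → ℝ) :
    weightedNorm α β (fun t => ∑ k : Fin (N + 1), v k * normJacobi α β k t) =
      ‖(WithLp.toLp 2 v : EuclideanSpace ℝ (Fin (N + 1)))‖ :=
  toReal_eLpNorm_sum_mul_of_orthonormal (e := fun k : Fin (N + 1) => normJacobi α β k)
    (fun k => memLp_weightMeasure_of_continuous hα hβ (continuous_normJacobi α β k))
    (fun j k => by
      simp only [integral_weightMeasure, integral_weight_mul_normJacobi hα hβ, Fin.val_inj]) v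

end WeightedNorm

/-! ### Least squares -/

section LeastSquares

open scoped Matrix.Norms.L2Operator in
theorem norm_inv_mul_transpose_mulVec_le {ι κ : Type*} [Fintype ι] [Fintype κ] [DecidableEq κ]
    (B : Matrix ι κ ℝ) (hB : IsUnit (B.transpose * B).det) (r : ι → ℝ) :
    ‖(WithLp.toLp 2 ((B.transpose * B)⁻¹.mulVec (B.transpose.mulVec r)) : EuclideanSpace ℝ κ)‖ ≤
      Real.sqrt ‖Matrix.toEuclideanCLM (n := κ) (𝕜 := ℝ) (B.transpose * B)⁻¹‖ *
        ‖(WithLp.toLp 2 r : EuclideanSpace ℝ ι)‖ := by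
  classical
  set A := B.transpose * B
  set D : Matrix κ ι ℝ := A⁻¹ * B.transpose
  have hDD : D * D.conjTranspose = A⁻¹ := by
    have hA : A.transpose = A := by rw [Matrix.transpose_mul, Matrix.transpose_transpose]
    rw [Matrix.conjTranspose_eq_transpose_of_trivial, Matrix.transpose_mul,
      Matrix.transpose_transpose, Matrix.transpose_nonsing_inv, hA, Matrix.mul_assoc,
      ← Matrix.mul_assoc B.transpose, Matrix.mul_nonsing_inv A hB, Matrix.mul_one]
  have hnorm : Real.sqrt ‖Matrix.toEuclideanCLM (n := κ) (𝕜 := ℝ) A⁻¹‖ = ‖D‖ := by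
    rw [Matrix.l2_opNorm_toEuclideanCLM, ← hDD, ← Matrix.l2_opNorm_conjTranspose D,
      ← Real.sqrt_mul_self (norm_nonneg D.conjTranspose), ← Matrix.l2_opNorm_conjTranspose_mul_self,
      Matrix.conjTranspose_conjTranspose]
  rw [hnorm, Matrix.mulVec_mulVec]
  exact Matrix.l2_opNorm_mulVec D (WithLp.toLp 2 r)

theorem apply_le_norm_toEuclideanCLM {ι : Type*} [Fintype ι] [DecidableEq ι] (A : Matrix ι ι ℝ)
    (i : ι) : A i i ≤ ‖Matrix.toEuclideanCLM (n := ι) (𝕜 := ℝ) A‖ := by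
  set e : EuclideanSpace ℝ ι := EuclideanSpace.single i 1
  have he : ‖e‖ = 1 := by simp [e]
  calc A i i = inner ℝ e (Matrix.toEuclideanCLM (n := ι) (𝕜 := ℝ) A e) := by
        rw [Matrix.inner_toEuclideanCLM]
        simp [e]
    _ ≤ ‖e‖ * ‖Matrix.toEuclideanCLM (n := ι) (𝕜 := ℝ) A e‖ := real_inner_le_norm _ _
    _ ≤ ‖Matrix.toEuclideanCLM (n := ι) (𝕜 := ℝ) A‖ := by
        simpa [he] using (Matrix.toEuclideanCLM (n := ι) (𝕜 := ℝ) A).le_opNorm e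

theorem norm_one_div_sqrt_mul_le {n : ℕ} (hn : 0 < n) {r : Fin n → ℝ} {K : ℝ}
    (hr : ∀ j, |r j| ≤ K) :
    ‖(WithLp.toLp 2 (fun j => 1 / Real.sqrt n * r j) : EuclideanSpace ℝ (Fin n))‖ ≤ K := by
  have hn0 : (0 : ℝ) < n := Nat.cast_pos.2 hn
  have hK : 0 ≤ K := (abs_nonneg _).trans (hr ⟨0, hn⟩)
  rw [EuclideanSpace.norm_eq]
  refine Real.sqrt_le_iff.2 ⟨hK, ?_⟩
  calc ∑ j, ‖1 / Real.sqrt n * r j‖ ^ 2 ≤ ∑ _j : Fin n, 1 / n * K ^ 2 := by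
        refine Finset.sum_le_sum fun j _ => ?_
        rw [Real.norm_eq_abs, sq_abs, mul_pow, div_pow, Real.sq_sqrt hn0.le, one_pow,
          ← sq_abs (r j)]
        gcongr
        exact hr j
    _ = K ^ 2 := by
        rw [Finset.sum_const, Finset.card_univ, Fintype.card_fin, nsmul_eq_mul]
        field_simp

variable {α β : ℝ} {N n : ℕ} {x : Fin n → ℝ}

theorem projMatrix_mulVec (α β : ℝ) (x : Fin n → ℝ) (v : Fin (N + 1) → ℝ) :
    (projMatrix α β N x).mulVec v =
      fun j => 1 / Real.sqrt n * ∑ k : Fin (N + 1), v k * normJacobi α β k (x j) := by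
  ext j
  simp only [Matrix.mulVec, dotProduct, projMatrix, Matrix.of_apply, Finset.mul_sum]
  exact Finset.sum_congr rfl fun k _ => by ring

theorem injective_projMatrix_mulVec (hα : -1 < α) (hβ : -1 < β) (hn : N + 1 ≤ n)
    (hx : Function.Injective x) : Function.Injective (projMatrix α β N x).mulVec := by
  have hn0 : (0 : ℝ) < n := Nat.cast_pos.2 (by omega)
  refine (injective_iff_map_eq_zero (Matrix.mulVecLin (projMatrix α β N x))).2 fun v hv => ?_
  set p := ∑ k : Fin (N + 1), v k • normJacobiSequence hα hβ k
  have hroot (j : Fin n) : p.eval (x j) = 0 := by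
    have hj := congrFun hv j
    simp only [Matrix.mulVecLin_apply, projMatrix_mulVec,
      ← eval_sum_smul_normJacobiSequence hα hβ] at hj
    exact (mul_eq_zero.1 hj).resolve_left (one_div_ne_zero (Real.sqrt_pos.2 hn0).ne')
  have hp : p = 0 := Polynomial.eq_zero_of_natDegree_lt_card_of_eval_eq_zero p hx hroot <| by
    rw [Fintype.card_fin]
    exact (Nat.lt_succ_of_le (natDegree_sum_smul_le _ v)).trans_le hn
  exact funext <| Fintype.linearIndependent_iff.1
    ((normJacobiSequence hα hβ).linearIndependent.comp _ Fin.val_injective) v hp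

theorem isUnit_det_gramMatrix (hα : -1 < α) (hβ : -1 < β) (hn : N + 1 ≤ n)
    (hx : Function.Injective x) : IsUnit (gramMatrix α β N x).det := by
  have h := Matrix.PosDef.conjTranspose_mul_self _ (injective_projMatrix_mulVec hα hβ hn hx)
  rw [Matrix.conjTranspose_eq_transpose_of_trivial] at h
  exact h.det_pos.ne'.isUnit

theorem inv_gammaConst_le_norm_gramMatrix (hα : -1 < α) (hβ : -1 < β) (N : ℕ) (hn : 0 < n)
    (x : Fin n → ℝ) :
    (gammaConst α β)⁻¹ ≤
      ‖Matrix.toEuclideanCLM (n := Fin (N + 1)) (𝕜 := ℝ) (gramMatrix α β N x)‖ := by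
  have hn0 : (0 : ℝ) < n := Nat.cast_pos.2 hn
  have hγ := gammaConst_pos hα hβ
  have hentry : gramMatrix α β N x 0 0 =
      n * (1 / Real.sqrt n * (1 / Real.sqrt (gammaConst α β))) ^ 2 := by
    simp [gramMatrix, Matrix.mul_apply, projMatrix, normJacobi_zero, sq]
  refine le_of_eq_of_le ?_ (apply_le_norm_toEuclideanCLM _ 0)
  rw [hentry, mul_pow, div_pow, div_pow, Real.sq_sqrt hn0.le, Real.sq_sqrt hγ.le]
  field_simp

theorem estimator_add (α β : ℝ) (N : ℕ) (x y z : Fin n → ℝ) (t : ℝ) :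
    estimator α β N x (fun j => y j + z j) t = estimator α β N x y t + estimator α β N x z t := by
  have hcoeffs : coeffs α β N x (fun j => y j + z j) = coeffs α β N x y + coeffs α β N x z := by
    simp only [coeffs, mul_add, ← Matrix.mulVec_add]
    rfl
  simp only [estimator, hcoeffs, Pi.add_apply, add_mul, Finset.sum_add_distrib]

theorem estimator_polynomial (hα : -1 < α) (hβ : -1 < β) (hdet : IsUnit (gramMatrix α β N x).det)
    {q : Polynomial ℝ} (hq : q.natDegree ≤ N) (t : ℝ) :
    estimator α β N x (fun j => q.eval (x j)) t = q.eval t := by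
  obtain ⟨d, rfl⟩ := exists_sum_smul_eq_of_natDegree_le (normJacobiSequence hα hβ) hq
  have hcoeffs : coeffs α β N x (fun j => ∑ k : Fin (N + 1), d k * normJacobi α β k (x j)) = d := by
    rw [coeffs, ← projMatrix_mulVec, Matrix.mulVec_mulVec, Matrix.mulVec_mulVec, Matrix.mul_assoc,
      ← gramMatrix, Matrix.nonsing_inv_mul _ hdet, Matrix.one_mulVec]
  simp only [eval_sum_smul_normJacobiSequence, estimator, hcoeffs]

theorem weightedNorm_estimator_le (hα : -1 < α) (hβ : -1 < β) (hn : 0 < n)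
    (hdet : IsUnit (gramMatrix α β N x).det) {y : Fin n → ℝ} {K : ℝ} (hy : ∀ j, |y j| ≤ K) :
    weightedNorm α β (estimator α β N x y) ≤
      Real.sqrt (condNumber (gramMatrix α β N x)) * (Real.sqrt (gammaConst α β) * K) := by
  set A := Matrix.toEuclideanCLM (n := Fin (N + 1)) (𝕜 := ℝ) (gramMatrix α β N x)
  set A' := Matrix.toEuclideanCLM (n := Fin (N + 1)) (𝕜 := ℝ) (gramMatrix α β N x)⁻¹
  have hK : 0 ≤ K := (abs_nonneg _).trans (hy ⟨0, hn⟩)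
  have hA : 1 ≤ Real.sqrt ‖A‖ * Real.sqrt (gammaConst α β) := by
    rw [← Real.sqrt_mul (norm_nonneg _), Real.one_le_sqrt,
      ← inv_le_iff_one_le_mul₀ (gammaConst_pos hα hβ)]
    exact inv_gammaConst_le_norm_gramMatrix hα hβ N hn x
  calc weightedNorm α β (estimator α β N x y)
      = ‖(WithLp.toLp 2 (coeffs α β N x y) : EuclideanSpace ℝ (Fin (N + 1)))‖ :=
        weightedNorm_sum_normJacobi hα hβ _
    _ ≤ Real.sqrt ‖A'‖ * ‖(WithLp.toLp 2 (fun j => 1 / Real.sqrt n * y j) :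
          EuclideanSpace ℝ (Fin n))‖ := norm_inv_mul_transpose_mulVec_le _ hdet _
    _ ≤ Real.sqrt ‖A'‖ * K := by gcongr; exact norm_one_div_sqrt_mul_le hn hy
    _ ≤ Real.sqrt ‖A'‖ * K * (Real.sqrt ‖A‖ * Real.sqrt (gammaConst α β)) :=
        le_mul_of_one_le_right (by positivity) hA
    _ = Real.sqrt (condNumber (gramMatrix α β N x)) * (Real.sqrt (gammaConst α β) * K) := by
        rw [condNumber, Real.sqrt_mul (norm_nonneg _)]
        ring

theorem weightedNorm_sub_estimator_le (hα : -1 < α) (hβ : -1 < β) (hn : 0 < n)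
    (hdet : IsUnit (gramMatrix α β N x).det) {f : ℝ → ℝ}
    (hf : AEStronglyMeasurable f (weightMeasure α β)) {q : Polynomial ℝ} (hq : q.natDegree ≤ N)
    {K L : ℝ} (hK : 0 ≤ K) (hfq : ∀ᵐ t ∂(weightMeasure α β), |f t - q.eval t| ≤ K)
    {y : Fin n → ℝ} (hy : ∀ j, |y j - q.eval (x j)| ≤ L) :
    weightedNorm α β (fun t => f t - estimator α β N x y t) ≤
      Real.sqrt (gammaConst α β) * K +
        Real.sqrt (condNumber (gramMatrix α β N x)) * (Real.sqrt (gammaConst α β) * L) := by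
  have := isFiniteMeasure_weightMeasure hα hβ
  set e := estimator α β N x fun j => y j - q.eval (x j)
  have he : Continuous e :=
    continuous_finsetSum _ fun k _ => continuous_const.mul (continuous_normJacobi α β k)
  have hsplit : (fun t => f t - estimator α β N x y t) = (fun t => f t - q.eval t) - e := by
    ext t
    have h := estimator_add α β N x (fun j => q.eval (x j)) (fun j => y j - q.eval (x j)) t
    simp only [add_sub_cancel] at h
    rw [h, estimator_polynomial hα hβ hdet hq, Pi.sub_apply, sub_add_eq_sub_sub]
  have hfqLp : MemLp (fun t => f t - q.eval t) 2 (weightMeasure α β) :=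
    MemLp.of_bound (hf.sub q.continuous.aestronglyMeasurable) K hfq
  rw [hsplit]
  exact (weightedNorm_sub_le hfqLp (memLp_weightMeasure_of_continuous hα hβ he)).trans <|
    add_le_add (weightedNorm_le_of_ae_bound hα hβ hK hfq)
      (weightedNorm_estimator_le hα hβ hn hdet hy)

end LeastSquares

/-! ### Fourier inversion and moments -/

section FourierInversion

open Filter

variable {V F : Type*} [NormedAddCommGroup V] [InnerProductSpace ℝ V] [FiniteDimensional ℝ V]
  [MeasurableSpace V] [BorelSpace V] [NormedAddCommGroup F]

theorem integral_fourierInv_smul_eq_of_integrable [NormedSpace ℂ F] [CompleteSpace F]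
    {φ : V → ℂ} {g : V → F} (hφ : Integrable φ) (hg : Integrable g) :
    ∫ ξ, 𝓕⁻ φ ξ • g ξ = ∫ x, φ x • 𝓕⁻ g x := by
  have hflip := VectorFourier.integral_fourierIntegral_smul_eq_flip (L := innerₗ V)
    Real.continuous_fourierChar continuous_inner hφ hg.comp_neg
  rw [flip_innerₗ] at hflip
  calc ∫ ξ, 𝓕⁻ φ ξ • g ξ = ∫ ξ, 𝓕 φ ξ • g (-ξ) := by
        rw [← integral_neg_eq_self]
        simp only [Real.fourierInv_eq_fourier_neg, neg_neg]
    _ = ∫ x, φ x • 𝓕 (fun ξ => g (-ξ)) x := hflip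
    _ = ∫ x, φ x • 𝓕⁻ g x := by rw [Real.fourierInv_eq_fourier_comp_neg]

theorem continuous_fourierInv_of_integrable [NormedSpace ℂ F] {g : V → F} (hg : Integrable g) :
    Continuous (𝓕⁻ g) := by
  have hsmooth : ContDiff ℝ (0 : ℕ∞) (𝓕 g) := Real.contDiff_fourier fun n hn => by
    obtain rfl : n = 0 := by simpa using hn
    simpa using hg.norm
  exact (hsmooth.continuous.comp continuous_neg).congr fun x =>
    (Real.fourierInv_eq_fourier_neg g x).symm

/- Against a Schwartz function `G`, Plancherel duality gives `∫ G • u = ∫ 𝓕⁻ G • 𝓕 u`, and for an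
integrable `𝓕 u` Fubini moves the inverse transform back. -/
theorem ae_eq_fourierInv_of_integrable [InnerProductSpace ℂ F] [CompleteSpace F]
    (u : Lp F 2 (volume : Measure V))
    (hint : Integrable (fun ξ => (𝓕 u : Lp F 2 (volume : Measure V)) ξ)) :
    ∀ᵐ x, u x = 𝓕⁻ (fun ξ => (𝓕 u : Lp F 2 (volume : Measure V)) ξ) x := by
  set φ : Lp F 2 (volume : Measure V) := 𝓕 u with hφ
  refine ae_eq_of_integral_contDiff_smul_eq ((Lp.memLp u).locallyIntegrable (by norm_num))
    (continuous_fourierInv_of_integrable hint).locallyIntegrable fun g hg hgc => ?_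
  have hgc' : HasCompactSupport (Complex.ofRealCLM ∘ g) := hgc.comp_left rfl
  let G : SchwartzMap V ℂ := hgc'.toSchwartzMap (by fun_prop)
  have hG (x : V) (v : F) : G x • v = g x • v := Complex.coe_smul (g x) v
  calc ∫ x, g x • u x = Lp.toTemperedDistribution u G := by
        simp only [Lp.toTemperedDistribution_apply, hG]
    _ = Lp.toTemperedDistribution φ (𝓕⁻ G) := by
        rw [← TemperedDistribution.fourierInv_apply, Lp.fourierInv_toTemperedDistribution_eq, hφ,
          FourierTransform.fourierInv_fourier_eq]
    _ = ∫ ξ, 𝓕⁻ (fun x => G x) ξ • φ ξ := by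
        rw [Lp.toTemperedDistribution_apply, SchwartzMap.fourierInv_coe]
    _ = ∫ x, G x • 𝓕⁻ (fun ξ => φ ξ) x :=
        integral_fourierInv_smul_eq_of_integrable G.integrable hint
    _ = ∫ x, g x • 𝓕⁻ (fun ξ => φ ξ) x := by simp only [hG]

end FourierInversion

section FourierDerivatives

variable {E : Type*} [NormedAddCommGroup E] [NormedSpace ℂ E] {φ : ℝ → E}

theorem contDiff_fourierInv (hφ : ∀ n : ℕ, Integrable fun ξ : ℝ => ξ ^ n • φ ξ) :
    ContDiff ℝ (⊤ : ℕ∞) (𝓕⁻ φ) := by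
  have hsmooth : ContDiff ℝ (⊤ : ℕ∞) (𝓕 φ) := Real.contDiff_fourier fun n _ =>
    (hφ n).norm.congr (Filter.Eventually.of_forall fun ξ => by simp [norm_smul])
  simpa only [Function.comp_def, ← Real.fourierInv_eq_fourier_neg] using hsmooth.comp contDiff_neg

theorem norm_iteratedDeriv_fourierInv_le (hφ : ∀ n : ℕ, Integrable fun ξ : ℝ => ξ ^ n • φ ξ)
    (n : ℕ) (x : ℝ) :
    ‖iteratedDeriv n (𝓕⁻ φ) x‖ ≤ (2 * Real.pi) ^ n * ∫ ξ : ℝ, |ξ| ^ n * ‖φ ξ‖ := by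
  have hneg : 𝓕⁻ φ = fun y => 𝓕 φ (-y) := funext (Real.fourierInv_eq_fourier_neg φ)
  rw [hneg, iteratedDeriv_comp_neg, norm_smul, norm_pow, norm_neg, norm_one, one_pow, one_mul,
    Real.iteratedDeriv_fourier (N := ⊤) (fun n _ => hφ n) le_top]
  refine (VectorFourier.norm_fourierIntegral_le_integral_norm _ _ _ _ _).trans_eq ?_
  rw [← integral_const_mul]
  refine integral_congr_ae (Filter.Eventually.of_forall fun ξ => ?_)
  simp only [norm_smul, norm_pow, norm_mul, norm_neg, Complex.norm_I, Complex.norm_real,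
    Complex.norm_ofNat, Real.norm_eq_abs, abs_of_pos Real.pi_pos]
  ring

theorem iteratedDeriv_clm_comp {𝕜 G H : Type*} [NontriviallyNormedField 𝕜] [NormedAddCommGroup G]
    [NormedSpace 𝕜 G] [NormedAddCommGroup H] [NormedSpace 𝕜 H] (L : G →L[𝕜] H) {h : 𝕜 → G} {n : ℕ}
    {x : 𝕜} (hh : ContDiffAt 𝕜 n h x) :
    iteratedDeriv n (fun y => L (h y)) x = L (iteratedDeriv n h x) := by
  change iteratedDeriv n (L ∘ h) x = _
  rw [iteratedDeriv_eq_iteratedFDeriv, iteratedDeriv_eq_iteratedFDeriv,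
    L.iteratedFDeriv_comp_left hh le_rfl]
  rfl

end FourierDerivatives

section Moments

variable {E : Type*} [NormedAddCommGroup E] {b : ℝ}

theorem memLp_indicator_pow (b : ℝ) (n : ℕ) :
    MemLp ((Icc (-b) b).indicator fun ξ : ℝ => ξ ^ n) 2 volume := by
  rw [memLp_indicator_iff_restrict measurableSet_Icc]
  refine MemLp.of_bound (by fun_prop) (b ^ n) ?_
  filter_upwards [ae_restrict_mem measurableSet_Icc] with ξ hξ
  rw [norm_pow, Real.norm_eq_abs]
  exact pow_le_pow_left₀ (abs_nonneg _) (abs_le.2 hξ) n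

theorem integral_sq_indicator_pow (hb : 0 ≤ b) (n : ℕ) :
    ∫ ξ : ℝ, ((Icc (-b) b).indicator (fun ξ => ξ ^ n) ξ) ^ 2 =
      2 * b ^ (2 * n + 1) / (2 * n + 1) := by
  have hsq (ξ : ℝ) : ((Icc (-b) b).indicator (fun ξ => ξ ^ n) ξ) ^ 2 =
      (Icc (-b) b).indicator (fun ξ => ξ ^ (2 * n)) ξ := by
    by_cases h : ξ ∈ Icc (-b) b <;> simp [h, ← pow_mul, mul_comm n]
  simp only [hsq]
  rw [integral_indicator measurableSet_Icc, integral_Icc_eq_integral_Ioc,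
    ← intervalIntegral.integral_of_le (by linarith), integral_pow, Odd.neg_pow ⟨n, rfl⟩]
  push_cast
  ring

theorem ae_eq_indicator_pow_smul [NormedSpace ℝ E] {φ : ℝ → E}
    (h0 : ∀ᵐ ξ : ℝ, b < |ξ| → φ ξ = 0) (n : ℕ) :
    ∀ᵐ ξ : ℝ, ξ ^ n • φ ξ = (Icc (-b) b).indicator (fun ξ => ξ ^ n) ξ • φ ξ := by
  filter_upwards [h0] with ξ hξ
  by_cases h : ξ ∈ Icc (-b) b
  · rw [indicator_of_mem h]
  · rw [hξ (lt_of_not_ge fun h' => h (abs_le.1 h')), smul_zero, smul_zero]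

variable [NormedSpace ℝ E] {φ : ℝ → E}

theorem integrable_pow_smul_of_ae_eq_zero (hφ : MemLp φ 2 volume)
    (h0 : ∀ᵐ ξ : ℝ, b < |ξ| → φ ξ = 0) (n : ℕ) : Integrable fun ξ : ℝ => ξ ^ n • φ ξ :=
  (integrable_congr (ae_eq_indicator_pow_smul h0 n)).2
    (memLp_one_iff_integrable.1 (hφ.smul (memLp_indicator_pow b n)))

theorem integral_abs_pow_mul_norm_le_of_ae_eq_zero (hφ : MemLp φ 2 volume) (hb : 0 ≤ b)
    (h0 : ∀ᵐ ξ : ℝ, b < |ξ| → φ ξ = 0) (n : ℕ) :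
    ∫ ξ : ℝ, |ξ| ^ n * ‖φ ξ‖ ≤
      Real.sqrt (2 * b ^ (2 * n + 1) / (2 * n + 1)) * (eLpNorm φ 2 volume).toReal := by
  set k : ℝ → ℝ := (Icc (-b) b).indicator fun ξ => ξ ^ n with hk
  calc ∫ ξ : ℝ, |ξ| ^ n * ‖φ ξ‖ = ∫ ξ : ℝ, ‖k ξ‖ * ‖‖φ ξ‖‖ := by
        refine integral_congr_ae ?_
        filter_upwards [ae_eq_indicator_pow_smul h0 n] with ξ hξ
        rw [norm_norm, ← norm_smul, ← hξ, norm_smul, norm_pow, Real.norm_eq_abs]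
    _ ≤ (∫ ξ, ‖k ξ‖ ^ (2 : ℝ)) ^ (1 / 2 : ℝ) * (∫ ξ, ‖‖φ ξ‖‖ ^ (2 : ℝ)) ^ (1 / 2 : ℝ) :=
        integral_mul_norm_le_Lp_mul_Lq Real.HolderConjugate.two_two
          (by simpa using memLp_indicator_pow b n) (by simpa using hφ.norm)
    _ = Real.sqrt (2 * b ^ (2 * n + 1) / (2 * n + 1)) * (eLpNorm φ 2 volume).toReal := by
        rw [hφ.eLpNorm_eq_integral_rpow_norm (by norm_num) (by norm_num),
          ENNReal.toReal_ofReal (by positivity), Real.sqrt_eq_rpow]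
        simp only [Real.rpow_two, Real.norm_eq_abs, sq_abs, hk, integral_sq_indicator_pow hb,
          abs_norm, ENNReal.toReal_ofNat, one_div]

end Moments

/-! ### Bandlimited functions -/

section BandlimitedApproximation

variable {c : ℝ}

theorem etaRate_nonneg {C : ℝ} (hC : 0 ≤ C) (hc : 0 ≤ c) (N : ℕ) : 0 ≤ etaRate C c N := by
  have := Real.exp_pos 1
  rw [etaRate]
  positivity

theorem etaRate_eq_mul (C c : ℝ) (N : ℕ) : etaRate C c N = C * etaRate 1 c N := by
  simp only [etaRate]
  ring

theorem etaRate_one (hc : 0 < c) (N : ℕ) :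
    etaRate 1 c N = c ^ (N + 1) * Real.sqrt c * (Real.exp 1 / (2 * N + 2)) ^ (N + 2) := by
  have hsqrt : c ^ (-(1 / 2) : ℝ) * c = Real.sqrt c := by
    rw [Real.rpow_neg hc.le, ← Real.sqrt_eq_rpow, inv_mul_eq_div, Real.div_sqrt]
  rw [etaRate, ← hsqrt, mul_div_right_comm, mul_pow]
  ring

theorem two_mul_add_two_div_exp_pow_le (N : ℕ) :
    ((2 * (N : ℝ) + 2) / Real.exp 1) ^ (N + 2) ≤
      Real.sqrt (Real.pi * (2 * N + 3)) * ((N + 1).factorial * 2 ^ N) := by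
  have hpi := Real.pi_gt_three
  have he : 1 ≤ Real.exp 1 := Real.one_le_exp zero_le_one
  set S := Real.sqrt (2 * Real.pi * (N + 1))
  set a := ((N : ℝ) + 1) / Real.exp 1
  have hstirling : S * a ^ (N + 1) ≤ (N + 1).factorial := by
    simpa only [Nat.cast_succ] using Stirling.le_factorial_stirling (N + 1)
  have ha : 4 * a ≤ S * S := by
    rw [Real.mul_self_sqrt (by positivity)]
    have : a ≤ N + 1 := div_le_self (by positivity) he
    nlinarith
  calc ((2 * (N : ℝ) + 2) / Real.exp 1) ^ (N + 2) = 4 * a * (a ^ (N + 1) * 2 ^ N) := by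
        rw [show (2 * (N : ℝ) + 2) / Real.exp 1 = 2 * a by ring, mul_pow]
        ring
    _ ≤ S * S * (a ^ (N + 1) * 2 ^ N) := by gcongr
    _ = S * (S * a ^ (N + 1) * 2 ^ N) := by ring
    _ ≤ S * ((N + 1).factorial * 2 ^ N) := by gcongr
    _ ≤ _ := mul_le_mul_of_nonneg_right (Real.sqrt_le_sqrt (by nlinarith)) (by positivity)

theorem derivative_bound_div_le_etaRate (hc : 0 < c) (N : ℕ) :
    c ^ (N + 1) * Real.sqrt c / Real.sqrt (Real.pi * (2 * N + 3)) / ((N + 1).factorial * 2 ^ N) ≤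
      etaRate 1 c N := by
  have := Real.exp_pos 1
  have hstirling := one_div_le_one_div_of_le (by positivity) (two_mul_add_two_div_exp_pow_le N)
  rw [one_div (_ ^ _), ← inv_pow, inv_div] at hstirling
  rw [etaRate_one hc, div_div, div_eq_mul_one_div]
  gcongr

theorem two_pi_pow_mul_sqrt (hc : 0 ≤ c) (n : ℕ) :
    (2 * Real.pi) ^ n * Real.sqrt (2 * (c / (2 * Real.pi)) ^ (2 * n + 1) / (2 * n + 1)) =
      c ^ n * Real.sqrt c / Real.sqrt (Real.pi * (2 * n + 1)) := by
  have := Real.pi_pos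
  rw [← Real.sqrt_sq (by positivity : 0 ≤ (2 * Real.pi) ^ n), ← Real.sqrt_sq (pow_nonneg hc n),
    ← Real.sqrt_mul (by positivity), ← Real.sqrt_mul (by positivity),
    ← Real.sqrt_div (by positivity)]
  congr 1
  rw [pow_succ _ (2 * n), mul_comm 2 n, pow_mul, div_pow]
  field_simp

theorem IsBandlimited.ae_fourier_eq_zero {g : ℝ → ℂ} (hg : IsBandlimited c g) (hgm : MemLp g 2) :
    ∀ᵐ ξ : ℝ, c / (2 * Real.pi) < |ξ| →
      (𝓕 (hgm.toLp g) : Lp ℂ 2 (volume : Measure ℝ)) ξ = 0 := by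
  obtain ⟨_, h0⟩ := hg
  filter_upwards [h0] with ξ hξ hcξ
  refine hξ ?_
  rw [abs_mul, abs_of_pos Real.two_pi_pos]
  exact (div_lt_iff₀' Real.two_pi_pos).1 hcξ

/- The smooth function is the inverse Fourier integral of the compactly supported transform; the
constant is the `L²` norm of `(2πξ)ⁿ` over the band. -/
theorem IsBandlimited.exists_contDiff (hc : 0 ≤ c) {g : ℝ → ℂ} (hg : IsBandlimited c g) :
    ∃ h : ℝ → ℂ, ContDiff ℝ (⊤ : ℕ∞) h ∧ (∀ᵐ x, g x = h x) ∧ ∀ (n : ℕ) (x : ℝ),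
      ‖iteratedDeriv n h x‖ ≤
        c ^ n * Real.sqrt c / Real.sqrt (Real.pi * (2 * n + 1)) * l2Norm g := by
  obtain ⟨hgm, -⟩ := id hg
  set φ : Lp ℂ 2 (volume : Measure ℝ) := 𝓕 (hgm.toLp g) with hφ
  have h0 := hg.ae_fourier_eq_zero hgm
  have hint := integrable_pow_smul_of_ae_eq_zero (Lp.memLp φ) h0
  have hnorm : (eLpNorm φ 2 volume).toReal = l2Norm g := by
    rw [← Lp.norm_def, hφ, Lp.norm_fourier_eq, Lp.norm_toLp, l2Norm]
  refine ⟨𝓕⁻ fun ξ => φ ξ, contDiff_fourierInv hint, ?_, fun n x => ?_⟩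
  · filter_upwards [ae_eq_fourierInv_of_integrable (hgm.toLp g) (by simpa using hint 0),
      hgm.coeFn_toLp] with x hu hgx
    rw [← hgx, hu]
  · calc ‖iteratedDeriv n (𝓕⁻ fun ξ => φ ξ) x‖
        ≤ (2 * Real.pi) ^ n * ∫ ξ : ℝ, |ξ| ^ n * ‖φ ξ‖ := norm_iteratedDeriv_fourierInv_le hint n x
      _ ≤ (2 * Real.pi) ^ n * (Real.sqrt (2 * (c / (2 * Real.pi)) ^ (2 * n + 1) / (2 * n + 1)) *
            (eLpNorm φ 2 volume).toReal) := by
          gcongr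
          exact integral_abs_pow_mul_norm_le_of_ae_eq_zero (Lp.memLp φ) (by positivity) h0 n
      _ = _ := by rw [← mul_assoc, two_pi_pow_mul_sqrt hc, hnorm]

theorem IsBandlimited.exists_polynomial_ae_abs_sub_le (hc : 0 < c) {g : ℝ → ℂ}
    (hg : IsBandlimited c g) (N : ℕ) :
    ∃ q : Polynomial ℝ, q.natDegree ≤ N ∧ ∀ᵐ x ∂(volume.restrict (Icc (-1 : ℝ) 1)),
      |(g x).re - q.eval x| ≤ etaRate 1 c N * l2Norm g := by
  obtain ⟨h, hsmooth, hgh, hbound⟩ := hg.exists_contDiff hc.le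
  have hre : ContDiff ℝ (N + 1 : ℕ) fun x => (h x).re :=
    Complex.reCLM.contDiff.comp (hsmooth.of_le (by exact_mod_cast le_top))
  have hderiv (t : ℝ) : |iteratedDeriv (N + 1) (fun x => (h x).re) t| ≤
      c ^ (N + 1) * Real.sqrt c / Real.sqrt (Real.pi * (2 * N + 3)) * l2Norm g := by
    have hcomm := iteratedDeriv_clm_comp (n := N + 1) (x := t) Complex.reCLM
      (hsmooth.contDiffAt.of_le (by exact_mod_cast le_top))
    simp only [Complex.reCLM_apply] at hcomm
    rw [hcomm]
    refine (Complex.abs_re_le_norm _).trans ((hbound (N + 1) t).trans_eq ?_)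
    push_cast
    ring_nf
  obtain ⟨q, hq, hqe⟩ := exists_polynomial_abs_sub_le N hre fun t _ => hderiv t
  refine ⟨q, hq, ?_⟩
  filter_upwards [ae_restrict_mem measurableSet_Icc, ae_restrict_of_ae hgh] with x hx hghx
  rw [hghx]
  refine (hqe x hx).trans ?_
  rw [mul_div_right_comm]
  exact mul_le_mul_of_nonneg_right (derivative_bound_div_le_etaRate hc N) ENNReal.toReal_nonneg

end BandlimitedApproximation

/-! ### Sampling and the denominator -/

section Probability

variable {Ω S : Type*} [MeasurableSpace Ω] [MeasurableSpace S] [MeasurableEq S] {P : Measure Ω}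
  [IsFiniteMeasure P]

theorem ae_ne_of_indepFun {Y Z : Ω → S} (hY : AEMeasurable Y P) (hZ : AEMeasurable Z P)
    (hind : IndepFun Y Z P) [NullSingletonClass (P.map Z)] : ∀ᵐ w ∂P, Y w ≠ Z w := by
  have hdiag : (P.map fun w => (Y w, Z w)) (diagonal S) = 0 := by
    rw [(indepFun_iff_map_prod_eq_prod_map_map hY hZ).1 hind,
      Measure.measure_prod_null measurableSet_diagonal]
    refine Filter.Eventually.of_forall fun y => ?_
    have hslice : Prod.mk y ⁻¹' diagonal S = {y} := by
      ext z
      simp [eq_comm]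
    simp only [hslice, measure_singleton, Pi.zero_apply]
  exact ae_of_ae_map (hY.prodMk hZ) (measure_eq_zero_iff_ae_notMem.1 hdiag)

theorem ae_injective_of_pairwise_indepFun {ι : Type*} [Countable ι] {X : ι → Ω → S}
    (hX : ∀ i, AEMeasurable (X i) P) (hind : Pairwise fun i j => IndepFun (X i) (X j) P)
    [∀ i, NullSingletonClass (P.map (X i))] : ∀ᵐ w ∂P, Function.Injective fun i => X i w := by
  have hne : ∀ᵐ w ∂P, ∀ i j, i ≠ j → X i w ≠ X j w := by
    simp only [ae_all_iff]
    exact fun i j hij => ae_ne_of_indepFun (hX i) (hX j) (hind hij)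
  filter_upwards [hne] with w hw i j
  exact not_imp_not.1 (hw i j)

end Probability

section Denominator

variable {α β δ : ℝ}

theorem deviation_nonneg (hδ : 0 < δ) (hδ2 : δ ≤ 2) (n : ℕ) : 0 ≤ deviation n δ := by
  have : 0 ≤ Real.log (2 / δ) := Real.log_nonneg ((one_le_div hδ).2 hδ2)
  exact Real.rpow_nonneg (by positivity) _

theorem tendsto_deviation (δ : ℝ) :
    Filter.Tendsto (fun n => deviation n δ) Filter.atTop (nhds 0) := by
  have hroot := ((tendsto_one_div_atTop_nhds_zero_nat (𝕜 := ℝ)).mul_const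
    (Real.log (2 / δ))).rpow_const (p := 1 / 4) (Or.inr (by norm_num))
  rwa [zero_mul, Real.zero_rpow (by norm_num)] at hroot

theorem exists_forall_denom_pos (hα : -1 < α) (hβ : -1 < β) (f : ℝ → ℝ) (δ : ℝ) :
    ∃ n₀ : ℕ, ∀ n, n₀ ≤ n → 0 < denom α β f n δ := by
  have hlim : Filter.Tendsto (fun n => denom α β f n δ) Filter.atTop
      (nhds (1 / Real.sqrt (gammaConst α β) - 2 * 0 * (supNorm f / weightedNorm α β f))) :=
    (((tendsto_deviation δ).const_mul 2).mul_const _).const_sub _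
  rw [mul_zero, zero_mul, sub_zero] at hlim
  exact Filter.eventually_atTop.1 (hlim.eventually_const_lt
    (one_div_pos.2 (Real.sqrt_pos.2 (gammaConst_pos hα hβ))))

theorem denom_le_one_div_sqrt_gammaConst (hδ : 0 < δ) (hδ2 : δ ≤ 2) (f : ℝ → ℝ) (n : ℕ) :
    denom α β f n δ ≤ 1 / Real.sqrt (gammaConst α β) :=
  sub_le_self _ (mul_nonneg (mul_nonneg two_pos.le (deviation_nonneg hδ hδ2 n))
    (div_nonneg ENNReal.toReal_nonneg ENNReal.toReal_nonneg))

theorem sqrt_gammaConst_mul_le_div_denom (hα : -1 < α) (hβ : -1 < β) (hδ : 0 < δ) (hδ2 : δ ≤ 2)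
    {f : ℝ → ℝ} {n : ℕ} (hpos : 0 < denom α β f n δ) {a : ℝ} (ha : 0 ≤ a) :
    Real.sqrt (gammaConst α β) * a ≤ (deviation n δ + a) / denom α β f n δ := by
  have hγ := Real.sqrt_pos.2 (gammaConst_pos hα hβ)
  rw [le_div_iff₀ hpos]
  calc Real.sqrt (gammaConst α β) * a * denom α β f n δ
      ≤ Real.sqrt (gammaConst α β) * a * (1 / Real.sqrt (gammaConst α β)) := by
        gcongr
        exact denom_le_one_div_sqrt_gammaConst hδ hδ2 f n
    _ = a := by field_simp
    _ ≤ deviation n δ + a := le_add_of_nonneg_left (deviation_nonneg hδ hδ2 n)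

end Denominator

theorem ae_weightedNorm_sub_estimator_le {α β : ℝ} (hα : -1 < α) (hβ : -1 < β) {c : ℝ} (hc : 0 < c)
    {f : ℝ → ℝ} {fbar : ℝ → ℂ} (hband : IsBandlimited c fbar)
    (hf : ∀ᵐ x ∂(volume.restrict (Icc (-1 : ℝ) 1)), f x = (fbar x).re) {n N : ℕ} (hNn : N + 1 ≤ n)
    {Ω : Type*} [MeasurableSpace Ω] {P : Measure Ω} [IsFiniteMeasure P] {X : Fin n → Ω → ℝ}
    (hX : ∀ i, AEMeasurable (X i) P)
    (hlaw : ∀ i, P.map (X i) ≪ volume.restrict (Icc (-1 : ℝ) 1))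
    (hind : Pairwise fun i j => IndepFun (X i) (X j) P) (ε : Fin n → Ω → ℝ) :
    ∀ᵐ w ∂P, IsUnit (gramMatrix α β N fun i => X i w).det ∧
      weightedNorm α β (fun t =>
          f t - estimator α β N (fun i => X i w) (fun i => f (X i w) + ε i w) t) ≤
        Real.sqrt (gammaConst α β) * (etaRate 1 c N * l2Norm fbar) +
          Real.sqrt (condNumber (gramMatrix α β N fun i => X i w)) *
            (Real.sqrt (gammaConst α β) * (etaRate 1 c N * l2Norm fbar + ⨆ i, |ε i w|)) := by
  obtain ⟨q, hq, hre⟩ := hband.exists_polynomial_ae_abs_sub_le hc N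
  have hfq : ∀ᵐ x ∂(volume.restrict (Icc (-1 : ℝ) 1)),
      |f x - q.eval x| ≤ etaRate 1 c N * l2Norm fbar := by
    filter_upwards [hf, hre] with x hfx hrex
    rwa [hfx]
  have hmeas : AEStronglyMeasurable f (volume.restrict (Icc (-1 : ℝ) 1)) :=
    (Complex.continuous_re.comp_aestronglyMeasurable hband.1.1.restrict).congr
      (hf.mono fun _ h => h.symm)
  have (i : Fin n) : NullSingletonClass (P.map (X i)) := ⟨fun x => hlaw i (measure_singleton x)⟩
  have hnodes : ∀ᵐ w ∂P, ∀ i, |f (X i w) - q.eval (X i w)| ≤ etaRate 1 c N * l2Norm fbar :=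
    ae_all_iff.2 fun i => ae_of_ae_map (hX i) ((hlaw i).ae_le hfq)
  have hμ := weightMeasure_absolutelyContinuous α β
  filter_upwards [ae_injective_of_pairwise_indepFun hX hind, hnodes] with w hinj hw
  have hdet := isUnit_det_gramMatrix hα hβ hNn hinj
  refine ⟨hdet, weightedNorm_sub_estimator_le hα hβ (by omega) hdet (hmeas.mono_ac hμ) hq
    (mul_nonneg (etaRate_nonneg zero_le_one hc.le N) ENNReal.toReal_nonneg) (hμ.ae_le hfq)
    fun i => ?_⟩
  have hε : |ε i w| ≤ ⨆ i, |ε i w| :=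
    le_ciSup (f := fun i => |ε i w|) (Set.finite_range _).bddAbove i
  rw [add_sub_right_comm]
  exact (abs_add_le _ _).trans (add_le_add (hw i) hε)

end JacobiRegression

open JacobiRegression in
theorem corollary2_general {α β : ℝ} (hα : -1 < α) (hβ : -1 < β) {c : ℝ} (hc : 0 < c) {f : ℝ → ℝ}
    {fbar : ℝ → ℂ} (hband : IsBandlimited c fbar)
    (hf : ∀ᵐ x ∂(volume.restrict (Icc (-1 : ℝ) 1)), f x = (fbar x).re) {δ : ℝ} (hδ : 0 < δ)
    (hδ2 : δ ≤ 2) :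
    weightedNorm α β f ≠ 0 → ∃ n₀ : ℕ, ∀ n N : ℕ, n₀ ≤ n → N + 1 ≤ n →
      0 < denom α β f n δ ∧
      ∀ (Ω : Type*) [MeasurableSpace Ω] (P : Measure Ω) [IsFiniteMeasure P] (X ε : Fin n → Ω → ℝ),
        (∀ i, AEMeasurable (X i) P) → (∀ i, P.map (X i) ≪ volume.restrict (Icc (-1 : ℝ) 1)) →
        (Pairwise fun i j => IndepFun (X i) (X j) P) →
        ∀ᵐ w ∂P, IsUnit (gramMatrix α β N fun i => X i w).det ∧
          weightedNorm α β (fun t =>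
              f t - estimator α β N (fun i => X i w) (fun i => f (X i w) + ε i w) t) ≤
            etaRate (Real.sqrt (gammaConst α β)) c N * l2Norm fbar +
              Real.sqrt (2 * condNumber (gramMatrix α β N fun i => X i w)) *
                ((deviation n δ + etaRate (Real.sqrt (gammaConst α β)) c N * l2Norm fbar /
                    Real.sqrt (gammaConst α β) + ⨆ i, |ε i w|) / denom α β f n δ) := by
  intro _
  obtain ⟨n₀, hn₀⟩ := exists_forall_denom_pos hα hβ f δ
  refine ⟨n₀, fun n N hn hNn => ⟨hn₀ n hn, fun Ω _ P _ X ε hX hlaw hind => ?_⟩⟩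
  filter_upwards [ae_weightedNorm_sub_estimator_le hα hβ hc hband hf hNn hX hlaw hind ε]
    with w ⟨hdet, hbound⟩
  have hγ := Real.sqrt_pos.2 (gammaConst_pos hα hβ)
  have he : 0 ≤ etaRate 1 c N * l2Norm fbar :=
    mul_nonneg (etaRate_nonneg zero_le_one hc.le N) ENNReal.toReal_nonneg
  have hε : 0 ≤ ⨆ i, |ε i w| := Real.iSup_nonneg fun i => abs_nonneg _
  have hκ : 0 ≤ condNumber (gramMatrix α β N fun i => X i w) :=
    mul_nonneg (norm_nonneg _) (norm_nonneg _)
  rw [etaRate_eq_mul (Real.sqrt _), mul_assoc, mul_div_cancel_left₀ _ hγ.ne',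
    add_assoc (deviation n δ)]
  refine ⟨hdet, hbound.trans ?_⟩
  gcongr
  · linarith
  · exact sqrt_gammaConst_mul_le_div_denom hα hβ hδ hδ2 (hn₀ n hn) (add_nonneg he hε)

open JacobiRegression in
theorem corollary2 (α : ℝ) (hα : -(1 / 2) ≤ α) :
    ∃ C : ℝ, 0 < C ∧
      ∀ (c : ℝ), 0 < c → ∀ (f : ℝ → ℝ) (fbar : ℝ → ℂ), IsBandlimited c fbar →
        (∀ x ∈ Icc (-1 : ℝ) 1, (f x : ℂ) = fbar x) → weightedNorm α α f ≠ 0 →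
      ∀ δ : ℝ, 0 < δ → δ < 1 →
      ∃ n₀ N₀ : ℕ, ∀ n N : ℕ, n₀ ≤ n → N₀ ≤ N → N + 1 ≤ n →
        0 < denom α α f n δ ∧
        ∀ (Ω : Type*) [MeasurableSpace Ω] (P : Measure Ω) [IsProbabilityMeasure P]
          (X ε : Fin n → Ω → ℝ),
          iIndepFun X P → (∀ i, HasLaw (X i) (betaLaw α α) P) → (∀ i, AEMeasurable (ε i) P) →
          ENNReal.ofReal ((1 - δ) ^ 2) ≤
            P {w | IsUnit (gramMatrix α α N fun i => X i w).det ∧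
              weightedNorm α α (fun t =>
                  f t - estimator α α N (fun i => X i w) (fun i => f (X i w) + ε i w) t) ≤
                etaRate C c N * l2Norm fbar +
                  Real.sqrt (2 * condNumber (gramMatrix α α N fun i => X i w)) *
                    ((deviation n δ + etaRate C c N * l2Norm fbar / Real.sqrt (gammaConst α α) +
                        ⨆ i, |ε i w|) / denom α α f n δ)}
          := by
  have hα' : -1 < α := by linarith
  refine ⟨Real.sqrt (gammaConst α α), Real.sqrt_pos.2 (gammaConst_pos hα' hα'),
    fun c hc f fbar hband hf hf0 δ hδ hδ1 => ?_⟩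
  have hre : ∀ᵐ x ∂(volume.restrict (Icc (-1 : ℝ) 1)), f x = (fbar x).re :=
    ae_restrict_of_forall_mem measurableSet_Icc fun x hx => by rw [← hf x hx, Complex.ofReal_re]
  obtain ⟨n₀, hn₀⟩ := corollary2_general hα' hα' hc hband hre hδ (by linarith) hf0
  refine ⟨n₀, 0, fun n N hn _ hNn => ⟨(hn₀ n N hn hNn).1, fun Ω _ P _ X ε hind hlaw _ => ?_⟩⟩
  have hae := (hn₀ n N hn hNn).2 Ω P X ε (fun i => (hlaw i).aemeasurable)
    (fun i => (hlaw i).map_eq ▸ withDensity_absolutelyContinuous _ _) fun i j => hind.indepFun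
  rw [measure_congr (Filter.eventuallyEq_univ.2 hae), measure_univ, ENNReal.ofReal_le_one]
  exact pow_le_one₀ (by linarith) (by linarith)
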